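/- Let $d\ge 1$, let $\Omega=C_0([0,1];\mathbb R^d)$ be the Banach space (supremum norm) of continuous paths $\gamma:[0,1]\to\mathbb R^d$ with $\gamma(0)=0$, and let $\nu$ be the Wiener measure on $\Omega$. Let $Z$ be the set of all functions $$F(\gamma)=f(\gamma(s_1),\dots,\gamma(s_k)),\qquad k\in\mathbb N,\ 0<s_1<\dots<s_k=1,$$ where $f:(\mathbb R^d)^k\to\mathbb R$ is smooth and $f$ and all its derivatives have at most polynomial growth. For $F\in Z$ put $D_sF(\gamma)=\sum_{i=1}^k (s_i\wedge s)\,(\nabla_{s_i}f)(\gamma(s_1),\dots,\gamma(s_k))$, $s\in[0,1]$, where $\nabla_{s_i}f$ is the gradient of $f$ in the $i$-th variable. Let $\langle h,k\rangle_{\mathbb H}=\int_0^1\langle h'(x),k'(x)\rangle_{\mathbb R^d}\,dx$ be the Cameron--Martin inner product. Let $H_1=1$ and, for $m\ge 0$ and $1\le k\le 2^m$, let $H_{2^m+k}$ be the Haar function equal to $2^{m/2}$ on $[\frac{k-1}{2^m},\frac{2k-1}{2^{m+1}})$, to $-2^{m/2}$ on $[\frac{2k-1}{2^{m+1}},\frac{k}{2^m})$,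 and to $0$ elsewhere. With the standard basis $e_1,\dots,e_d$ of $\mathbb R^d$ let $g_{d(r-1)+j}=H_r e_j$ ($r\ge1$, $1\le j\le d$) and $S_n(s)=\int_0^s g_n(u)\,du$. Let $0<\lambda_1\le\lambda_2\le\dots$ be real numbers, and let $\varphi:\Omega\to\mathbb R$ be measurable with $0<\varphi\le c$ $\nu$-a.e. for some constant $c$ and $$\frac{f}{\varphi}\in L^1(\nu)\qquad\text{for all } f\in Z .$$ Define $$\mathcal E(F,G)=\sum_{n=1}^\infty\lambda_n\int\langle S_n,DF\rangle_{\mathbb H}\,\langle S_n,DG\rangle_{\mathbb H}\,\varphi\,d\nu ,\qquad F,G\in Z_0:=\{F\in Z:\ \mathcal E(F,F)<\infty\}.$$ 1. Let $c_0=0$ and $c_1,c_2,\ldots\in\{0,1\}$, and put $i_{p,j}=2^{p-1}(d+j-1)+1+\sum_{q=0}^{p-1}c_q2^{p-q-1}$. If $\sum_{p=1}^\infty \lambda_{i_{p,j}}2^{-p}<\infty$ for all $j\in\{1,\dots,d\}$, then $Z_0=Z$. 2. The form $(\mathcal E,Z_0)$ is closable on $L^2(\varphi\nu)$. Consequently its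 closure $(\mathcal E,D_Z(\mathcal E))$ is well defined: $D_Z(\mathcal E)$ is the set of all $u\in L^2(\varphi\nu)$ for which there are $F_n\in Z_0$ with $F_n\to u$ in $L^2(\varphi\nu)$ and $\mathcal E(F_n-F_m,F_n-F_m)\to0$ as $n,m\to\infty$; and $\mathcal E(u,v)=\lim_n\mathcal E(F_n,G_n)$ for any such sequences $(F_n)$ for $u$ and $(G_n)$ for $v$. 3. The form $(\mathcal E,D_Z(\mathcal E))$ is local: $\mathcal E(u,v)=0$ for all $u,v\in D_Z(\mathcal E)$ with $\operatorname{supp}u\cap\operatorname{supp}v=\emptyset$, where $\operatorname{supp}u$ denotes the topological support in $\Omega$ of the measure $|u|\,\varphi\nu$. -/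

import Mathlib

open MeasureTheory ProbabilityTheory Filter Topology
open scoped ENNReal

noncomputable section

namespace WienerForm

/-! ### The Wiener space -/

/-- `ℝ^d` with its Euclidean structure. -/
abbrev E (d : ℕ) : Type := EuclideanSpace ℝ (Fin d)

/-- The linear space `C_0([0,1]; ℝ^d)` of continuous paths starting at `0`. -/
def pathSubmodule (d : ℕ) : Submodule ℝ C(unitInterval, E d) where
  carrier := {γ | γ 0 = 0}
  add_mem' := by
    intro a b ha hb
    have ha' : a 0 = 0 := ha
    have hb' : b 0 = 0 := hb
    simp [ha', hb']
  zero_mem' := by simp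
  smul_mem' := by
    intro c a ha
    have ha' : a 0 = 0 := ha
    simp [ha']

/-- The state space `Ω = C_0([0,1]; ℝ^d)`, with the supremum norm. -/
abbrev Path (d : ℕ) : Type := pathSubmodule d

/-- `Ω` carries its Borel σ-algebra. -/
instance (d : ℕ) : MeasurableSpace (Path d) := borel _

instance (d : ℕ) : BorelSpace (Path d) := ⟨rfl⟩

/-- `ν` is the Wiener measure on `Ω`: the coordinate process has independent increments, and
`γ(t) - γ(s)` is distributed as `√(t - s)` times a standard Gaussian vector. -/
structure IsWienerMeasure {d : ℕ} (ν : Measure (Path d)) : Prop where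
  isProbabilityMeasure : IsProbabilityMeasure ν
  indep : HasIndepIncrements (fun (t : unitInterval) (γ : Path d) => γ.1 t) ν
  law : ∀ s t : unitInterval, s ≤ t →
    HasLaw (fun γ : Path d => γ.1 t - γ.1 s)
      ((stdGaussian (E d)).map (fun x => √((t : ℝ) - (s : ℝ)) • x)) ν

/-! ### Cylindrical functions and the gradient -/

/-- A presentation `F(γ) = f(γ(s_1), …, γ(s_k))` with `0 < s_1 < … < s_k = 1` of a cylindrical
function. The time points form a finite set, and `f` is smooth and has, together with all its
derivatives, at most polynomial growth. -/
structure CylinderRep (d : ℕ) where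
  times : Finset unitInterval
  pos : ∀ t ∈ times, 0 < t
  one_mem : (1 : unitInterval) ∈ times
  f : (times → E d) → ℝ
  smooth : f.HasTemperateGrowth

namespace CylinderRep

variable {d : ℕ}

/-- The values of a path at the time points. -/
def eval (r : CylinderRep d) (γ : Path d) : r.times → E d := fun t => γ.1 t

/-- The cylindrical function `γ ↦ f(γ(s_1), …, γ(s_k))`. -/
def toFun (r : CylinderRep d) (γ : Path d) : ℝ := r.f (r.eval γ)

/-- `∇_{s_i} f`, the gradient of `f` in the `i`-th variable, the others being held fixed. -/
def partialGrad (r : CylinderRep d) (t : r.times) (x : r.times → E d) : E d :=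
  gradient (fun y => r.f (Function.update x t y)) (x t)

/-- `D_s F(γ) = ∑ i, (s_i ∧ s) (∇_{s_i} f)(γ)`, as a function of `s`. -/
def grad (r : CylinderRep d) (γ : Path d) (s : ℝ) : E d :=
  ∑ t : r.times, min (t.1 : ℝ) s • r.partialGrad t (r.eval γ)

/-- The path `u ↦ (u ∧ s) v`. -/
def ramp (s : ℝ) (hs : 0 ≤ s) (v : E d) : Path d :=
  ⟨⟨fun u => min (u : ℝ) s • v, by fun_prop⟩, by
    change min ((0 : unitInterval) : ℝ) s • v = 0
    simp [hs]⟩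

/-- The gradient is a directional derivative of the cylindrical function. -/
lemma inner_grad (r : CylinderRep d) (γ : Path d) (s : ℝ) (hs : 0 ≤ s) (v : E d) :
    inner ℝ (r.grad γ s) v = deriv (fun ε : ℝ => r.toFun (γ + ε • ramp s hs v)) 0 := by
  classical
  have hd : DifferentiableAt ℝ r.f (r.eval γ) :=
    (r.smooth.1.differentiable (by simp)).differentiableAt
  have hline : HasDerivAt (fun ε : ℝ => r.eval γ + ε • r.eval (ramp s hs v))
      (r.eval (ramp s hs v)) 0 := by
    simpa using ((hasDerivAt_id (0 : ℝ)).smul_const (r.eval (ramp s hs v))).const_add (r.eval γ)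
  have hd' : HasFDerivAt r.f (fderiv ℝ r.f (r.eval γ))
      (r.eval γ + (0 : ℝ) • r.eval (ramp s hs v)) := by
    simpa using hd.hasFDerivAt
  have h1 := hd'.comp_hasDerivAt (0 : ℝ) hline
  have h2 : (fun ε : ℝ => r.toFun (γ + ε • ramp s hs v)) =
      r.f ∘ fun ε : ℝ => r.eval γ + ε • r.eval (ramp s hs v) := rfl
  rw [h2, h1.deriv]
  have hsum : r.eval (ramp s hs v) =
      ∑ t : r.times, Pi.single t (r.eval (ramp s hs v) t) :=
    (Finset.univ_sum_single _).symm
  rw [hsum, map_sum, grad, sum_inner]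
  refine Finset.sum_congr rfl fun t _ => ?_
  have h3 : HasFDerivAt (fun y => r.f (Function.update (r.eval γ) t y))
      ((fderiv ℝ r.f (r.eval γ)).comp (ContinuousLinearMap.pi
        (Pi.single t (ContinuousLinearMap.id ℝ (E d))))) (r.eval γ t) := by
    have hu := hasFDerivAt_update (𝕜 := ℝ) (r.eval γ) (i := t) (r.eval γ t)
    have hd2 : HasFDerivAt r.f (fderiv ℝ r.f (r.eval γ))
        (Function.update (r.eval γ) t (r.eval γ t)) := by
      simpa using hd.hasFDerivAt
    exact hd2.comp _ hu
  have h4 : inner ℝ (r.partialGrad t (r.eval γ)) v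
      = fderiv ℝ r.f (r.eval γ) (Pi.single t v) := by
    rw [partialGrad, gradient, InnerProductSpace.toDual_symm_apply, h3.fderiv]
    simp only [ContinuousLinearMap.comp_apply]
    congr 1
    ext u
    by_cases hut : u = t
    · subst hut; simp
    · simp [hut]
  have h5 : r.eval (ramp s hs v) t = min (t.1 : ℝ) s • v := rfl
  rw [h5, real_inner_smul_left, h4, ← smul_eq_mul, ← map_smul, Pi.single_smul]

/-- The gradient does not depend on the presentation of the cylindrical function. -/
lemma grad_eq_of_toFun_eq {r r' : CylinderRep d} (h : r.toFun = r'.toFun) (γ : Path d)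
    {s : ℝ} (hs : 0 ≤ s) : r.grad γ s = r'.grad γ s := by
  refine ext_inner_right ℝ fun v => ?_
  rw [inner_grad r γ s hs, inner_grad r' γ s hs, h]

end CylinderRep

/-- The set `Z` of all cylindrical functions. -/
def cylinderFunctions (d : ℕ) : Set (Path d → ℝ) := Set.range CylinderRep.toFun

/-- `Z` is closed under differences, so that the form can be evaluated at `F - G`. -/
lemma sub_mem_cylinderFunctions {d : ℕ} {F G : Path d → ℝ} (hF : F ∈ cylinderFunctions d)
    (hG : G ∈ cylinderFunctions d) : F - G ∈ cylinderFunctions d := by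
  classical
  obtain ⟨r, rfl⟩ := hF
  obtain ⟨r', rfl⟩ := hG
  let L : (↑(r.times ∪ r'.times) → E d) →L[ℝ] (r.times → E d) :=
    ContinuousLinearMap.pi fun t =>
      ContinuousLinearMap.proj ⟨t.1, Finset.mem_union_left _ t.2⟩
  let L' : (↑(r.times ∪ r'.times) → E d) →L[ℝ] (r'.times → E d) :=
    ContinuousLinearMap.pi fun t =>
      ContinuousLinearMap.proj ⟨t.1, Finset.mem_union_right _ t.2⟩
  refine ⟨⟨r.times ∪ r'.times, ?_, Finset.mem_union_left _ r.one_mem,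
    fun x => r.f (L x) - r'.f (L' x), ?_⟩, rfl⟩
  · intro t ht
    rcases Finset.mem_union.1 ht with h | h
    · exact r.pos t h
    · exact r'.pos t h
  · exact (r.smooth.comp L.hasTemperateGrowth).sub (r'.smooth.comp L'.hasTemperateGrowth)

open Classical in
/-- The gradient `D F(γ)` of `F ∈ Z`, computed from any presentation of `F`. -/
def malliavinD {d : ℕ} (F : Path d → ℝ) (γ : Path d) : ℝ → E d :=
  if h : F ∈ cylinderFunctions d then (Classical.choose h).grad γ else 0

/-- `malliavinD` is given by the defining formula for every presentation. -/
lemma malliavinD_toFun {d : ℕ} (r : CylinderRep d) (γ : Path d) {s : ℝ} (hs : 0 ≤ s) :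
    malliavinD r.toFun γ s = r.grad γ s := by
  have h : r.toFun ∈ cylinderFunctions d := ⟨r, rfl⟩
  rw [malliavinD, dif_pos h]
  exact CylinderRep.grad_eq_of_toFun_eq (Classical.choose_spec h) γ hs

/-! ### The Cameron-Martin inner product and the Schauder functions -/

/-- The Cameron-Martin inner product `∫ ⟨h'(x), k'(x)⟩ dx` over `[0,1]` (the derivatives exist
almost everywhere for absolutely continuous `h`, `k`). -/
def cmInner {d : ℕ} (h k : ℝ → E d) : ℝ :=
  ∫ x in (0 : ℝ)..1, inner ℝ (deriv h x) (deriv k x)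

/-- The Haar function with index `2^m + k`, `1 ≤ k ≤ 2^m`. -/
def haarLevel (m k : ℕ) (t : ℝ) : ℝ :=
  if t ∈ Set.Ico (((k : ℝ) - 1) / 2 ^ m) ((2 * (k : ℝ) - 1) / 2 ^ (m + 1)) then
    (2 : ℝ) ^ ((m : ℝ) / 2)
  else if t ∈ Set.Ico ((2 * (k : ℝ) - 1) / 2 ^ (m + 1)) ((k : ℝ) / 2 ^ m) then
    -(2 : ℝ) ^ ((m : ℝ) / 2)
  else 0

/-- The Haar functions, enumerated from zero: `haar r` is `H_{r+1}`. -/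
def haar (r : ℕ) (t : ℝ) : ℝ :=
  if r = 0 then 1 else haarLevel (Nat.log 2 r) (r + 1 - 2 ^ Nat.log 2 r) t

/-- `H_{2^m+k}` is the Haar function of level `m` and position `k`. -/
lemma haar_eq (m k : ℕ) (h1 : 1 ≤ k) (h2 : k ≤ 2 ^ m) :
    haar (2 ^ m + k - 1) = haarLevel m k := by
  have hlog : Nat.log 2 (2 ^ m + k - 1) = m :=
    Nat.log_eq_of_pow_le_of_lt_pow (by omega) (by rw [pow_succ]; omega)
  have hpos : 0 < 2 ^ m := by positivity
  have h3 : 2 ^ m + k - 1 ≠ 0 := by omega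
  have h4 : 2 ^ m + k - 1 + 1 - 2 ^ m = k := by omega
  funext t
  simp only [haar, if_neg h3, hlog, h4]

/-- The functions `g_1, g_2, …`, enumerated from zero: `haarVec d (d * r + j)` is
`H_{r+1} e_{j+1}`. -/
def haarVec (d : ℕ) [NeZero d] (n : ℕ) (t : ℝ) : E d :=
  haar (n / d) t • EuclideanSpace.single (Fin.ofNat d n) 1

lemma haarVec_eq (d : ℕ) [NeZero d] (r : ℕ) (j : Fin d) (t : ℝ) :
    haarVec d (d * r + j) t = haar r t • EuclideanSpace.single j 1 := by
  have hd : 0 < d := Nat.pos_of_ne_zero (NeZero.ne d)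
  have h1 : (d * r + j) / d = r := by
    rw [Nat.mul_add_div hd, Nat.div_eq_of_lt j.2, add_zero]
  have h2 : Fin.ofNat d (d * r + j) = j := by
    ext
    simp [Fin.ofNat, Nat.mod_eq_of_lt j.2]
  rw [haarVec, h1, h2]

/-- The Schauder functions, enumerated from zero: `schauder d n` is `S_{n+1}`. -/
def schauder (d : ℕ) [NeZero d] (n : ℕ) (s : ℝ) : E d := ∫ u in (0 : ℝ)..s, haarVec d n u

/-! ### Closable forms, closures and locality -/

/-- A form given on a set `dom` of functions; `form` is only meaningful on `dom`. -/
structure FunctionForm (α : Type*) where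
  dom : Set (α → ℝ)
  form : (α → ℝ) → (α → ℝ) → ℝ

/-- A form on a subset `dom` of `L²(μ)`; `form` is only meaningful on `dom`. -/
structure L2Form {α : Type*} [MeasurableSpace α] (μ : Measure α) where
  dom : Set (Lp ℝ 2 μ)
  form : Lp ℝ 2 μ → Lp ℝ 2 μ → ℝ

namespace FunctionForm

variable {α : Type*} [MeasurableSpace α]

/-- `(F_n)` is a Cauchy sequence for the form. -/
def IsFormCauchy (𝓔 : FunctionForm α) (F : ℕ → α → ℝ) : Prop :=
  Tendsto (fun p : ℕ × ℕ => 𝓔.form (F p.1 - F p.2) (F p.1 - F p.2)) atTop (𝓝 0)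

/-- Closability on `L²(μ)`. -/
def IsClosable (𝓔 : FunctionForm α) (μ : Measure α) : Prop :=
  ∀ F : ℕ → α → ℝ, (∀ n, F n ∈ 𝓔.dom) →
    Tendsto (fun n => eLpNorm (F n) 2 μ) atTop (𝓝 0) → 𝓔.IsFormCauchy F →
    Tendsto (fun n => 𝓔.form (F n) (F n)) atTop (𝓝 0)

/-- `(F_n)` is a form-Cauchy sequence in the domain that converges to `u` in `L²(μ)`. -/
def Approximates (𝓔 : FunctionForm α) {μ : Measure α} (F : ℕ → α → ℝ) (u : Lp ℝ 2 μ) : Prop :=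
  (∀ n, F n ∈ 𝓔.dom) ∧ Tendsto (fun n => eLpNorm (F n - (u : α → ℝ)) 2 μ) atTop (𝓝 0) ∧
    𝓔.IsFormCauchy F

open Classical in
/-- The closure on `L²(μ)`: its domain consists of the limits `u` of form-Cauchy sequences, and
`𝓔(u, v) = lim 𝓔(F_n, G_n)` for sequences `F_n → u`, `G_n → v` of this kind. -/
def closure (𝓔 : FunctionForm α) (μ : Measure α) : L2Form μ where
  dom := {u | ∃ F, 𝓔.Approximates F u}
  form u v :=
    if h : (∃ F, 𝓔.Approximates F u) ∧ ∃ G, 𝓔.Approximates G v then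
      limUnder atTop fun n => 𝓔.form (Classical.choose h.1 n) (Classical.choose h.2 n)
    else 0

end FunctionForm

/-- The support of `u ∈ L²(μ)`, that is, the topological support of the measure `|u| μ`. -/
def l2Support {α : Type*} [TopologicalSpace α] [MeasurableSpace α] {μ : Measure α}
    (u : Lp ℝ 2 μ) : Set α :=
  (μ.withDensity fun x => ‖u x‖ₑ).support

/-- The local property: `𝓔(u, v) = 0` whenever `u`, `v` in the domain have disjoint supports. -/
def L2Form.IsLocal {α : Type*} [TopologicalSpace α] [MeasurableSpace α] {μ : Measure α}
    (𝓔 : L2Form μ) : Prop :=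
  ∀ u ∈ 𝓔.dom, ∀ v ∈ 𝓔.dom, Disjoint (l2Support u) (l2Support v) → 𝓔.form u v = 0

/-! ### The form on Wiener space -/

variable {d : ℕ}

/-- The measure `φ ν`. -/
def weighted (φ : Path d → ℝ) (ν : Measure (Path d)) : Measure (Path d) :=
  ν.withDensity fun γ => ENNReal.ofReal (φ γ)

/-- The `n`-th summand `λ_n ∫ ⟨S_n, DF⟩ ⟨S_n, DG⟩ φ dν`, where `lam n` is `λ_{n+1}`. -/
def energyTerm [NeZero d] (lam : ℕ → ℝ) (φ : Path d → ℝ) (ν : Measure (Path d))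
    (F G : Path d → ℝ) (n : ℕ) : ℝ :=
  lam n * ∫ γ, cmInner (schauder d n) (malliavinD F γ) *
    cmInner (schauder d n) (malliavinD G γ) * φ γ ∂ν

/-- `𝓔(F, F) < ∞`. -/
def FiniteEnergy [NeZero d] (lam : ℕ → ℝ) (φ : Path d → ℝ) (ν : Measure (Path d))
    (F : Path d → ℝ) : Prop :=
  Summable (energyTerm lam φ ν F F)

/-- The form `𝓔(F, G) = ∫ ⟨DF, A DG⟩ φ dν = ∑ n, λ_n ∫ ⟨S_n, DF⟩ ⟨S_n, DG⟩ φ dν` on the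
functions in `Z` of finite energy. -/
def wienerForm [NeZero d] (lam : ℕ → ℝ) (φ : Path d → ℝ) (ν : Measure (Path d)) :
    FunctionForm (Path d) where
  dom := {F | F ∈ cylinderFunctions d ∧ FiniteEnergy lam φ ν F}
  form F G := ∑' n, energyTerm lam φ ν F G n

/-- The condition `∑_{p ≥ 1} λ_{i_{p,j}} / 2^p < ∞` for all `j = 1, …, d`, where
`i_{p,j} = 2^{p-1} (d + j - 1) + 1 + ∑_{q=0}^{p-1} c_q 2^{p-q-1}`. Here `p` and `j` are counted
from zero, and `lam n` is `λ_{n+1}`. -/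
def DyadicSummable (d : ℕ) (lam : ℕ → ℝ) (c : ℕ → ℕ) : Prop :=
  ∀ j : Fin d, Summable fun p : ℕ =>
    lam (2 ^ p * (d + j) + ∑ q ∈ Finset.range (p + 1), c q * 2 ^ (p - q)) / 2 ^ (p + 1)

end WienerForm

end

namespace WienerForm

variable {d : ℕ}

/-! ### The algebra of cylindrical functions -/

/-! Write ∂_h F for the derivative of F along a path h. Since S_n is the primitive of g_n, ⟨S_n, DF⟩
is ∂_{S_n} F (`cmInner_schauder`). Hence F ↦ (√λ_n ∂_{S_n} F)_n maps Z_0 linearly into the Hilbert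
space ℓ²(L²(φν)) and turns the form into the inner product (`form_eq_inner`). Form-Cauchy sequences
then have limits ξ there, and claims 2 and 3 reduce to one fact: if F_k → u in L²(φν) and these
vectors tend to ξ, then every ξ_n vanishes a.e. on {u = 0}. With u = 0 this is closability. Applied
to differences, it shows that ξ depends on u alone. If u and v have disjoint supports, then u = 0 or
v = 0 at almost every point, so each term of ⟨ξ, η⟩ is zero.

To prove the fact, note that 1/φ ∈ L¹(ν) embeds L²(φν) into L¹(ν), so φ never has to be
differentiated: F_k → u ν-a.e. along a subsequence, and ∂_h F_k → w in L¹(ν). Take A smooth with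
compact support and A'(0) = 1, and put A_N(x) = A(Nx)/N. Then A_N = O(1/N) uniformly, while A_N' is
bounded and tends to the indicator of {0}. Integrating ∂_h(A_N(F_k)) G by parts under ν gives O(1/N)
uniformly in k. Letting k → ∞ and then N → ∞ yields ∫ w 1_{u=0} G dν = 0 for every bounded G in Z,
and such G determine integrable functions.

The integration by parts is Stein's identity. The ramp u ↦ (u ∧ s)v represents the covariance with
⟨γ(s), v⟩, which is therefore its divergence, and Schauder functions are finite combinations of
ramps (`hasDivergence_schauderPath`).

For claim 1, ∂_{S_n} F is a finite sum of terms S_n(t) times partial derivatives of f. At a fixed t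
at most one Haar index per level m contributes, with square at most 2^{-m}, and monotonicity bounds
λ_n by a term of the assumed series (`summable_mul_scalarSchauder`). -/

lemma _root_.Function.HasTemperateGrowth.prodMk {V W₁ W₂ : Type*} [NormedAddCommGroup V]
    [NormedSpace ℝ V] [NormedAddCommGroup W₁] [NormedSpace ℝ W₁] [NormedAddCommGroup W₂]
    [NormedSpace ℝ W₂] {f : V → W₁} {g : V → W₂} (hf : f.HasTemperateGrowth)
    (hg : g.HasTemperateGrowth) : (fun x => (f x, g x)).HasTemperateGrowth := by
  have h := ((ContinuousLinearMap.inl ℝ W₁ W₂).hasTemperateGrowth.comp hf).add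
    ((ContinuousLinearMap.inr ℝ W₁ W₂).hasTemperateGrowth.comp hg)
  convert h using 1
  ext x <;> simp

lemma _root_.Function.HasTemperateGrowth.fderiv_apply_const {V W : Type*} [NormedAddCommGroup V]
    [NormedSpace ℝ V] [NormedAddCommGroup W] [NormedSpace ℝ W] {f : V → W}
    (hf : f.HasTemperateGrowth) (v : V) : (fun x => fderiv ℝ f x v).HasTemperateGrowth := by
  have h : (fderiv ℝ f).HasTemperateGrowth := by
    refine ⟨hf.1.fderiv_right (by simp), fun n => ?_⟩
    obtain ⟨k, C, h⟩ := hf.2 (n + 1)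
    exact ⟨k, C, fun x => by rw [norm_iteratedFDeriv_fderiv]; exact h x⟩
  exact (ContinuousLinearMap.apply ℝ W v).hasTemperateGrowth.comp h

lemma CylinderRep.continuous_eval (r : CylinderRep d) : Continuous r.eval := by
  unfold CylinderRep.eval
  fun_prop

lemma continuous_of_mem {F : Path d → ℝ} (hF : F ∈ cylinderFunctions d) : Continuous F := by
  obtain ⟨r, rfl⟩ := hF
  exact r.smooth.1.continuous.comp r.continuous_eval

lemma comp_mem {F : Path d → ℝ} (hF : F ∈ cylinderFunctions d) {Φ : ℝ → ℝ}
    (hΦ : Φ.HasTemperateGrowth) : (fun γ => Φ (F γ)) ∈ cylinderFunctions d := by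
  obtain ⟨r, rfl⟩ := hF
  exact ⟨⟨r.times, r.pos, r.one_mem, fun x => Φ (r.f x), hΦ.comp r.smooth⟩, rfl⟩

/-- Both functions are read off the union of their time sets. Polynomial Φ makes Z an algebra. -/
lemma comp₂_mem {F G : Path d → ℝ} (hF : F ∈ cylinderFunctions d)
    (hG : G ∈ cylinderFunctions d) {Φ : ℝ × ℝ → ℝ} (hΦ : Φ.HasTemperateGrowth) :
    (fun γ => Φ (F γ, G γ)) ∈ cylinderFunctions d := by
  classical
  obtain ⟨r, rfl⟩ := hF
  obtain ⟨r', rfl⟩ := hG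
  let L : (↑(r.times ∪ r'.times) → E d) →L[ℝ] (r.times → E d) :=
    ContinuousLinearMap.pi fun t =>
      ContinuousLinearMap.proj ⟨t.1, Finset.mem_union_left _ t.2⟩
  let L' : (↑(r.times ∪ r'.times) → E d) →L[ℝ] (r'.times → E d) :=
    ContinuousLinearMap.pi fun t =>
      ContinuousLinearMap.proj ⟨t.1, Finset.mem_union_right _ t.2⟩
  refine ⟨⟨r.times ∪ r'.times, ?_, Finset.mem_union_left _ r.one_mem,
    fun x => Φ (r.f (L x), r'.f (L' x)), ?_⟩, rfl⟩
  · intro t ht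
    rcases Finset.mem_union.1 ht with h | h
    · exact r.pos t h
    · exact r'.pos t h
  · exact hΦ.comp ((r.smooth.comp L.hasTemperateGrowth).prodMk
      (r'.smooth.comp L'.hasTemperateGrowth))

lemma add_mem {F G : Path d → ℝ} (hF : F ∈ cylinderFunctions d)
    (hG : G ∈ cylinderFunctions d) : (fun γ => F γ + G γ) ∈ cylinderFunctions d :=
  comp₂_mem hF hG ((ContinuousLinearMap.fst ℝ ℝ ℝ).hasTemperateGrowth.add
    (ContinuousLinearMap.snd ℝ ℝ ℝ).hasTemperateGrowth)

lemma mul_mem {F G : Path d → ℝ} (hF : F ∈ cylinderFunctions d)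
    (hG : G ∈ cylinderFunctions d) : (fun γ => F γ * G γ) ∈ cylinderFunctions d :=
  comp₂_mem hF hG ((ContinuousLinearMap.fst ℝ ℝ ℝ).hasTemperateGrowth.mul
    (ContinuousLinearMap.snd ℝ ℝ ℝ).hasTemperateGrowth)

lemma const_mem (a : ℝ) : (fun _ => a) ∈ cylinderFunctions d :=
  ⟨⟨{1}, by simp, by simp, fun _ => a, .const a⟩, rfl⟩

lemma const_mul_mem {F : Path d → ℝ} (hF : F ∈ cylinderFunctions d) (a : ℝ) :
    (fun γ => a * F γ) ∈ cylinderFunctions d :=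
  mul_mem (const_mem a) hF

lemma comp_eval_mem {t : unitInterval} (ht : 0 < t) {Φ : E d → ℝ} (hΦ : Φ.HasTemperateGrowth) :
    (fun γ : Path d => Φ (γ.1 t)) ∈ cylinderFunctions d := by
  classical
  refine ⟨⟨{t, 1}, by simp [ht], by simp, fun x => Φ (x ⟨t, by simp⟩), ?_⟩, rfl⟩
  exact hΦ.comp (ContinuousLinearMap.proj (R := ℝ)
    (φ := fun _ : ↑({t, 1} : Finset unitInterval) => E d) ⟨t, by simp⟩).hasTemperateGrowth

lemma inner_eval_mem (t : unitInterval) (v : E d) :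
    (fun γ : Path d => inner ℝ (γ.1 t) v) ∈ cylinderFunctions d := by
  -- Time 0 is not admissible in a presentation, but there the function vanishes because paths start
  -- at 0.
  rcases eq_or_lt_of_le (unitInterval.nonneg' : 0 ≤ t) with rfl | ht
  · have h : (fun γ : Path d => inner ℝ (γ.1 0) v) = fun _ => 0 := by
      funext γ
      have : γ.1 0 = 0 := γ.2
      simp [this]
    rw [h]
    exact const_mem 0
  · exact comp_eval_mem ht (Function.hasTemperateGrowth_inner_left v)

/-! ### Directional derivatives of cylindrical functions -/

/-- Evaluation at the time points is linear, so the derivative along h is that of f along the values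
of h. Line derivatives make sense without choosing a presentation. -/
lemma CylinderRep.hasLineDerivAt (r : CylinderRep d) (γ h : Path d) :
    HasLineDerivAt ℝ r.toFun (fderiv ℝ r.f (r.eval γ) (r.eval h)) γ h := by
  have hd : HasFDerivAt r.f (fderiv ℝ r.f (r.eval γ)) (r.eval γ) :=
    (r.smooth.1.differentiable (by simp)).differentiableAt.hasFDerivAt
  exact hd.hasLineDerivAt (r.eval h)

lemma CylinderRep.lineDeriv_eq (r : CylinderRep d) (γ h : Path d) :
    lineDeriv ℝ r.toFun γ h = fderiv ℝ r.f (r.eval γ) (r.eval h) :=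
  (r.hasLineDerivAt γ h).lineDeriv

lemma hasLineDerivAt_of_mem {F : Path d → ℝ} (hF : F ∈ cylinderFunctions d) (γ h : Path d) :
    HasLineDerivAt ℝ F (lineDeriv ℝ F γ h) γ h := by
  obtain ⟨r, rfl⟩ := hF
  rw [r.lineDeriv_eq]
  exact r.hasLineDerivAt γ h

lemma lineDeriv_mem {F : Path d → ℝ} (hF : F ∈ cylinderFunctions d) (h : Path d) :
    (fun γ => lineDeriv ℝ F γ h) ∈ cylinderFunctions d := by
  obtain ⟨r, rfl⟩ := hF
  exact ⟨⟨r.times, r.pos, r.one_mem, fun x => fderiv ℝ r.f x (r.eval h),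
    r.smooth.fderiv_apply_const _⟩, funext fun γ => (r.lineDeriv_eq γ h).symm⟩

lemma lineDeriv_add_dir {F : Path d → ℝ} (hF : F ∈ cylinderFunctions d) (γ h k : Path d) :
    lineDeriv ℝ F γ (h + k) = lineDeriv ℝ F γ h + lineDeriv ℝ F γ k := by
  obtain ⟨r, rfl⟩ := hF
  simp only [r.lineDeriv_eq]
  exact map_add _ (r.eval h) (r.eval k)

lemma lineDeriv_mul {F G : Path d → ℝ} (hF : F ∈ cylinderFunctions d)
    (hG : G ∈ cylinderFunctions d) (γ h : Path d) :
    lineDeriv ℝ (fun γ => F γ * G γ) γ h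
      = lineDeriv ℝ F γ h * G γ + F γ * lineDeriv ℝ G γ h := by
  have h1 := HasDerivAt.mul (hasLineDerivAt_of_mem hF γ h) (hasLineDerivAt_of_mem hG γ h)
  simp only [zero_smul, add_zero] at h1
  exact HasLineDerivAt.lineDeriv h1

lemma lineDeriv_sub {F G : Path d → ℝ} (hF : F ∈ cylinderFunctions d)
    (hG : G ∈ cylinderFunctions d) (γ h : Path d) :
    lineDeriv ℝ (F - G) γ h = lineDeriv ℝ F γ h - lineDeriv ℝ G γ h :=
  HasLineDerivAt.lineDeriv
    (HasDerivAt.sub (hasLineDerivAt_of_mem hF γ h) (hasLineDerivAt_of_mem hG γ h))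

lemma lineDeriv_comp {F : Path d → ℝ} (hF : F ∈ cylinderFunctions d) {Φ : ℝ → ℝ}
    (hΦ : Differentiable ℝ Φ) (γ h : Path d) :
    lineDeriv ℝ (fun γ => Φ (F γ)) γ h = deriv Φ (F γ) * lineDeriv ℝ F γ h := by
  have h0 : HasDerivAt Φ (deriv Φ (F γ)) (F (γ + (0 : ℝ) • h)) := by
    simpa using (hΦ (F γ)).hasDerivAt
  exact HasLineDerivAt.lineDeriv (h0.comp (0 : ℝ) (hasLineDerivAt_of_mem hF γ h))

/-! ### Gaussian integration by parts -/

section Stein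

variable {Ω V : Type*} [MeasurableSpace Ω] {P : Measure Ω} [NormedAddCommGroup V]
  [NormedSpace ℝ V] [CompleteSpace V] [MeasurableSpace V] [BorelSpace V]
  [SecondCountableTopology V]

/-- Functions of temperate growth are integrable with respect to Gaussian laws. -/
lemma integrable_comp_of_hasGaussianLaw {X : Ω → V} (hX : HasGaussianLaw X P) {f : V → ℝ}
    (hf : f.HasTemperateGrowth) : Integrable (fun ω => f (X ω)) P := by
  have := hX.isProbabilityMeasure
  obtain ⟨k, C, hC⟩ := hf.2 0
  have hm : AEStronglyMeasurable (fun ω => f (X ω)) P :=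
    (hf.1.continuous.measurable.comp_aemeasurable hX.aemeasurable).aestronglyMeasurable
  have h1 : MemLp (fun ω => 1 + ‖X ω‖) (k : ℝ≥0∞) P :=
    (memLp_const (1 : ℝ)).add (hX.memLp (ENNReal.natCast_ne_top k)).norm
  have h2 : Integrable (fun ω => C * ‖1 + ‖X ω‖‖ ^ k) P := h1.integrable_norm_pow'.const_mul C
  have h3 : ∀ x, ‖f x‖ ≤ C * (1 + ‖x‖) ^ k := fun x => by
    rw [← norm_iteratedFDeriv_zero (𝕜 := ℝ)]
    exact hC x
  refine h2.mono' hm (ae_of_all _ fun ω => (h3 (X ω)).trans_eq ?_)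
  rw [Real.norm_of_nonneg (by positivity : (0 : ℝ) ≤ 1 + ‖X ω‖)]

/-- Stein's identity for a centered Gaussian law on the line. -/
lemma integral_deriv_gaussianReal {v : NNReal} (hv : v ≠ 0) {g : ℝ → ℝ}
    (hg : g.HasTemperateGrowth) :
    v * ∫ x, deriv g x ∂gaussianReal 0 v = ∫ x, g x * x ∂gaussianReal 0 v := by
  have hint : ∀ {f : ℝ → ℝ}, f.HasTemperateGrowth →
      Integrable (fun x => gaussianPDFReal 0 v x * f x) := by
    intro f hf
    have h1 : Integrable f (gaussianReal 0 v) :=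
      integrable_comp_of_hasGaussianLaw IsGaussian.hasGaussianLaw_id hf
    rw [gaussianReal_of_var_ne_zero _ hv,
      integrable_withDensity_iff (measurable_gaussianPDF _ _)
        (ae_of_all _ fun _ => gaussianPDF_lt_top)] at h1
    simpa [toReal_gaussianPDF, mul_comm] using h1
  have hg' : (deriv g).HasTemperateGrowth := hg.fderiv_apply_const 1
  -- The Gaussian density p satisfies p' = -x p / v, so Stein's identity is integration by parts on
  -- the line.
  have hpdf : ∀ x, HasDerivAt (gaussianPDFReal 0 v) (-(gaussianPDFReal 0 v x * x) / v) x := by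
    intro x
    have h1 : HasDerivAt (fun x : ℝ => -(x - 0) ^ 2 / (2 * v)) (-(2 * x) / (2 * v)) x := by
      have := ((((hasDerivAt_id x).sub_const 0).pow 2).neg).div_const (2 * (v : ℝ))
      simpa using this
    have h2 := (h1.exp).const_mul ((√(2 * Real.pi * v))⁻¹)
    have hv' : (v : ℝ) ≠ 0 := by exact_mod_cast hv
    refine HasDerivAt.congr_deriv (f := gaussianPDFReal 0 v) h2 ?_
    rw [show gaussianPDFReal 0 v x
      = (√(2 * Real.pi * v))⁻¹ * Real.exp (-(x - 0) ^ 2 / (2 * v)) from rfl]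
    field_simp
  have hid : (fun x : ℝ => x).HasTemperateGrowth := .id'
  have key := integral_mul_deriv_eq_deriv_mul_of_integrable (u := g) (v := gaussianPDFReal 0 v)
    (u' := deriv g) (v' := fun x => -(gaussianPDFReal 0 v x * x) / v)
    (fun x _ => (hg.1.differentiable (by simp) x).hasDerivAt) (fun x _ => hpdf x)
    (by
      refine ((hint (hg.mul hid)).neg.div_const (v : ℝ)).congr (ae_of_all _ fun x => ?_)
      simp only [Pi.mul_apply, Pi.neg_apply]; ring)
    (by
      refine (hint hg').congr (ae_of_all _ fun x => ?_)
      simp only [Pi.mul_apply]; ring)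
    (by
      refine (hint hg).congr (ae_of_all _ fun x => ?_)
      simp only [Pi.mul_apply]; ring)
  rw [integral_gaussianReal_eq_integral_smul hv, integral_gaussianReal_eq_integral_smul hv]
  have hv' : (v : ℝ) ≠ 0 := by exact_mod_cast hv
  have h1 : ∫ x, gaussianPDFReal 0 v x • deriv g x = ∫ x, deriv g x * gaussianPDFReal 0 v x :=
    integral_congr_ae (ae_of_all _ fun x => by simp [mul_comm])
  have h2 : ∫ x, gaussianPDFReal 0 v x • (g x * x)
      = -v * ∫ x, g x * (-(gaussianPDFReal 0 v x * x) / v) := by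
    rw [← integral_const_mul]
    refine integral_congr_ae (ae_of_all _ fun x => ?_)
    simp only [smul_eq_mul]
    field_simp
  rw [h1, h2, key]
  ring

/-- Gaussian integration by parts: if `ξ` is centered, `(X, ξ)` is jointly Gaussian and `v`
represents the covariance of `X` with `ξ`, then `𝔼[∂_v f (X)] = 𝔼[f(X) ξ]`. -/
lemma integral_fderiv_of_hasGaussianLaw {X : Ω → V} {ξ : Ω → ℝ}
    (hX : HasGaussianLaw (fun ω => (X ω, ξ ω)) P) (h0 : ∫ ω, ξ ω ∂P = 0) {v : V}
    (hcov : ∀ L : StrongDual ℝ V, cov[fun ω => L (X ω), ξ; P] = L v) {f : V → ℝ}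
    (hf : f.HasTemperateGrowth) :
    ∫ ω, fderiv ℝ f (X ω) v ∂P = ∫ ω, f (X ω) * ξ ω ∂P := by
  have := hX.isProbabilityMeasure
  have hξ : HasGaussianLaw ξ P := hX.snd
  -- If ξ has variance zero, it vanishes a.s.; all covariances are then zero, so v = 0 and both
  -- sides are zero.
  rcases eq_or_ne (Var[ξ; P].toNNReal) 0 with hσ | hσ
  · have hvar : Var[ξ; P] = 0 :=
      le_antisymm (Real.toNNReal_eq_zero.1 hσ) (variance_nonneg _ _)
    have hξ0 : ξ =ᵐ[P] 0 := by
      have h1 := ae_eq_integral_of_variance_eq_zero hξ.memLp_two hvar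
      rw [h0] at h1
      exact h1
    have hv0 : v = 0 := by
      refine SeparatingDual.eq_zero_of_forall_dual_eq_zero (R := ℝ) fun L => ?_
      rw [← hcov L, covariance, h0]
      refine integral_eq_zero_of_ae ?_
      filter_upwards [hξ0] with ω hω
      simp [hω]
    subst hv0
    simp only [map_zero, integral_zero]
    refine (integral_eq_zero_of_ae ?_).symm
    filter_upwards [hξ0] with ω hω
    simp [hω]
  set σ : NNReal := Var[ξ; P].toNNReal with hσdef
  have hσ' : (σ : ℝ) ≠ 0 := by exact_mod_cast hσ
  have hσvar : (σ : ℝ) = Var[ξ; P] := Real.coe_toNNReal _ (variance_nonneg _ _)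
  -- Y is the residual of the regression of X on ξ, with σ the variance of ξ. It is uncorrelated
  -- with ξ, hence independent of it by joint Gaussianity; Fubini then reduces the claim to the
  -- line.
  let Y : Ω → V := fun ω => X ω - (ξ ω / σ) • v
  let T : V × ℝ →L[ℝ] V × ℝ :=
    (ContinuousLinearMap.fst ℝ V ℝ - (σ : ℝ)⁻¹ • (ContinuousLinearMap.snd ℝ V ℝ).smulRight v).prod
      (ContinuousLinearMap.snd ℝ V ℝ)
  have hT : ∀ ω, T (X ω, ξ ω) = (Y ω, ξ ω) := by
    intro ω
    simp [T, Y, smul_smul, div_eq_inv_mul]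
  have hYξ : HasGaussianLaw (fun ω => (Y ω, ξ ω)) P := by
    simpa only [hT] using hX.map_fun T
  have hYm : AEMeasurable Y P := hYξ.fst.aemeasurable
  have hLX : ∀ L : StrongDual ℝ V, MemLp (fun ω => L (X ω)) 2 P := fun L =>
    (hX.fst.map_fun L).memLp_two
  have hindep : IndepFun Y ξ P := by
    refine hYξ.indepFun_of_covariance_strongDual fun L₁ L₂ => ?_
    have h1 : L₁ ∘ Y = fun ω => L₁ (X ω) - (L₁ v / σ) * ξ ω := by
      funext ω
      simp [Y]
      ring
    have h2 : L₂ ∘ ξ = fun ω => ξ ω * L₂ 1 := by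
      funext ω
      have : ξ ω = ξ ω • (1 : ℝ) := by simp
      simp only [Function.comp_apply]
      conv_lhs => rw [this, map_smul]
      simp
    rw [h1, h2, covariance_mul_const_right,
      covariance_fun_sub_left (hLX L₁) (hξ.memLp_two.const_mul _) hξ.memLp_two, hcov,
      covariance_const_mul_left, covariance_self hξ.aemeasurable, ← hσvar]
    field_simp
    simp
  have hmap : P.map (fun ω => (Y ω, ξ ω)) = (P.map Y).prod (gaussianReal 0 σ) := by
    rw [(indepFun_iff_map_prod_eq_prod_map_map hYm hξ.aemeasurable).1 hindep,
      hξ.map_eq_gaussianReal, h0]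
  have hS : ∀ ω, X ω = Y ω + (ξ ω / σ) • v := fun ω => by simp [Y]
  let A : V × ℝ →L[ℝ] V :=
    ContinuousLinearMap.fst ℝ V ℝ + (σ : ℝ)⁻¹ • (ContinuousLinearMap.snd ℝ V ℝ).smulRight v
  have hA : ∀ y x, A (y, x) = y + (x / σ) • v := by
    intro y x
    simp [A, smul_smul, div_eq_inv_mul]
  have htrans : ∀ {Φ : V × ℝ → ℝ}, Φ.HasTemperateGrowth →
      ∫ ω, Φ (Y ω, ξ ω) ∂P = ∫ y, ∫ x, Φ (y, x) ∂gaussianReal 0 σ ∂(P.map Y) := by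
    intro Φ hΦ
    have hprob : IsProbabilityMeasure (P.map Y) := Measure.isProbabilityMeasure_map hYm
    have h1 : Integrable Φ ((P.map Y).prod (gaussianReal 0 σ)) := by
      rw [← hmap, integrable_map_measure hΦ.1.continuous.aestronglyMeasurable hYξ.aemeasurable]
      exact integrable_comp_of_hasGaussianLaw hYξ hΦ
    rw [← integral_prod _ h1, ← hmap,
      integral_map hYξ.aemeasurable hΦ.1.continuous.aestronglyMeasurable]
  have e1 : ∫ ω, fderiv ℝ f (X ω) v ∂P
      = ∫ y, ∫ x, fderiv ℝ f (A (y, x)) v ∂gaussianReal 0 σ ∂(P.map Y) := by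
    rw [← htrans (Φ := fun p => fderiv ℝ f (A p) v)
      ((hf.fderiv_apply_const v).comp A.hasTemperateGrowth)]
    simp only [hA, hS]
  have e2 : ∫ ω, f (X ω) * ξ ω ∂P
      = ∫ y, ∫ x, f (A (y, x)) * x ∂gaussianReal 0 σ ∂(P.map Y) := by
    rw [← htrans (Φ := fun p => f (A p) * p.2)
      ((hf.comp A.hasTemperateGrowth).mul (ContinuousLinearMap.snd ℝ V ℝ).hasTemperateGrowth)]
    simp only [hA, hS]
  rw [e1, e2]
  refine integral_congr_ae (ae_of_all _ fun y => ?_)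
  simp only
  have haff : (fun x : ℝ => A (y, x)).HasTemperateGrowth :=
    A.hasTemperateGrowth.comp ((Function.HasTemperateGrowth.const y).prodMk .id')
  refine Eq.trans ?_ (integral_deriv_gaussianReal hσ (hf.comp haff))
  rw [← integral_const_mul]
  refine integral_congr_ae (ae_of_all _ fun x => ?_)
  -- Along x ↦ y + (x/σ)v the derivative of f is σ⁻¹ ∂_v f; the factor σ in Stein's identity cancels
  -- σ⁻¹.
  have h1 : HasDerivAt (fun x : ℝ => A (y, x)) ((σ : ℝ)⁻¹ • v) x := by
    simp only [hA, div_eq_inv_mul]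
    simpa using (((hasDerivAt_id x).const_mul ((σ : ℝ)⁻¹)).smul_const v).const_add y
  have h2 := ((hf.1.differentiable (by simp) (A (y, x))).hasFDerivAt.comp_hasDerivAt x h1).deriv
  change _ = (σ : ℝ) * deriv (f ∘ fun x => A (y, x)) x
  rw [h2, map_smul, smul_eq_mul]
  field_simp

end Stein

/-! ### Integration by parts on Wiener space -/

section Wiener

variable {ν : Measure (Path d)}

@[simp]
lemma path_zero (γ : Path d) : γ.1 0 = 0 := γ.2

lemma measurable_eval (t : unitInterval) : Measurable (fun γ : Path d => γ.1 t) :=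
  Continuous.measurable (by fun_prop)

lemma IsWienerMeasure.hasLaw_eval (hν : IsWienerMeasure ν) (t : unitInterval) :
    HasLaw (fun γ : Path d => γ.1 t) ((stdGaussian (E d)).map (fun x => √(t : ℝ) • x)) ν := by
  simpa using hν.law 0 t unitInterval.nonneg'

lemma isGaussian_map_smul (c : ℝ) : IsGaussian ((stdGaussian (E d)).map (fun x => c • x)) := by
  have h := isGaussian_map (μ := stdGaussian (E d)) (c • ContinuousLinearMap.id ℝ (E d))
  exact h

lemma IsWienerMeasure.isGaussianProcess (hν : IsWienerMeasure ν) :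
    IsGaussianProcess (fun (t : unitInterval) (γ : Path d) => γ.1 t) ν := by
  refine HasIndepIncrements.isGaussianProcess (fun t => ?_) (ae_of_all _ fun γ => γ.2) hν.indep
  have := isGaussian_map_smul (d := d) √(t : ℝ)
  exact (hν.hasLaw_eval t).hasGaussianLaw

lemma IsWienerMeasure.memLp_inner (hν : IsWienerMeasure ν) (t : unitInterval) (v : E d) :
    MemLp (fun γ : Path d => inner ℝ v (γ.1 t)) 2 ν :=
  ((hν.isGaussianProcess.hasGaussianLaw_eval t).map_fun (innerSL ℝ v)).memLp_two

lemma IsWienerMeasure.integral_inner (hν : IsWienerMeasure ν) (t : unitInterval) (v : E d) :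
    ∫ γ, inner ℝ v (γ.1 t) ∂ν = 0 := by
  have h := (hν.hasLaw_eval t).integral_comp (f := fun x => inner ℝ v x)
    (by fun_prop)
  rw [Function.comp_def] at h
  rw [h, integral_map (by fun_prop) (by fun_prop)]
  simp only [inner_smul_right, integral_const_mul]
  have := integral_strongDual_stdGaussian (innerSL ℝ v)
  simp only [innerSL_apply_apply] at this
  rw [this, mul_zero]

lemma IsWienerMeasure.covariance_self_time (hν : IsWienerMeasure ν) (t : unitInterval)
    (v w : E d) :
    cov[fun γ : Path d => inner ℝ v (γ.1 t), fun γ => inner ℝ w (γ.1 t); ν]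
      = t * inner ℝ v w := by
  have h : cov[fun γ : Path d => inner ℝ v (γ.1 t), fun γ => inner ℝ w (γ.1 t); ν]
      = cov[fun x => inner ℝ v x, fun x => inner ℝ w x; ν.map (fun γ => γ.1 t)] :=
    (covariance_map_fun (by fun_prop) (by fun_prop) (measurable_eval t).aemeasurable).symm
  rw [h, (hν.hasLaw_eval t).map_eq, covariance_map_fun (by fun_prop) (by fun_prop) (by fun_prop)]
  simp only [inner_smul_right]
  rw [covariance_const_mul_left, covariance_const_mul_right, ← mul_assoc,
    Real.mul_self_sqrt t.2.1, ← covarianceBilin_apply_eq_cov IsGaussian.memLp_two_id,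
    covarianceBilin_stdGaussian, innerSL_apply_apply]

/-- Split γ(t) into γ(s) and an increment independent of γ(s); the increment contributes no
covariance. -/
lemma IsWienerMeasure.covariance_of_le (hν : IsWienerMeasure ν) {s t : unitInterval}
    (hst : s ≤ t) (v w : E d) :
    cov[fun γ : Path d => inner ℝ v (γ.1 s), fun γ => inner ℝ w (γ.1 t); ν]
      = s * inner ℝ v w := by
  have := hν.isProbabilityMeasure
  have hind : IndepFun (fun γ : Path d => γ.1 s) (fun γ : Path d => γ.1 t - γ.1 s) ν :=
    hν.indep.indepFun_eval_sub (r := 0) unitInterval.nonneg' hst (ae_of_all _ fun γ => γ.2)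
  have hind' : IndepFun (fun γ : Path d => inner ℝ v (γ.1 s))
      (fun γ : Path d => inner ℝ w (γ.1 t - γ.1 s)) ν :=
    hind.comp (φ := fun x => inner ℝ v x) (ψ := fun x => inner ℝ w x) (by fun_prop) (by fun_prop)
  have hsub : MemLp (fun γ : Path d => inner ℝ w (γ.1 t - γ.1 s)) 2 ν := by
    simp only [inner_sub_right]
    exact (hν.memLp_inner t w).sub (hν.memLp_inner s w)
  have h1 : (fun γ : Path d => inner ℝ w (γ.1 t))
      = (fun γ => inner ℝ w (γ.1 s)) + fun γ => inner ℝ w (γ.1 t - γ.1 s) := by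
    funext γ
    simp [inner_sub_right]
  rw [h1, covariance_add_right (hν.memLp_inner s v) (hν.memLp_inner s w) hsub,
    hν.covariance_self_time, hind'.covariance_eq_zero (hν.memLp_inner s v) hsub, add_zero]

lemma IsWienerMeasure.covariance_inner (hν : IsWienerMeasure ν) (s t : unitInterval)
    (v w : E d) :
    cov[fun γ : Path d => inner ℝ v (γ.1 s), fun γ => inner ℝ w (γ.1 t); ν]
      = min (s : ℝ) t * inner ℝ v w := by
  rcases le_total s t with h | h
  · rw [hν.covariance_of_le h, min_eq_left (by exact_mod_cast h)]
  · rw [covariance_comm, hν.covariance_of_le h, min_eq_right (by exact_mod_cast h),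
      real_inner_comm]

lemma IsWienerMeasure.hasGaussianLaw_restrict (hν : IsWienerMeasure ν) (r : CylinderRep d) :
    HasGaussianLaw r.eval ν :=
  hν.isGaussianProcess.hasGaussianLaw r.times

lemma IsWienerMeasure.integrable_of_mem (hν : IsWienerMeasure ν) {F : Path d → ℝ}
    (hF : F ∈ cylinderFunctions d) : Integrable F ν := by
  obtain ⟨r, rfl⟩ := hF
  exact integrable_comp_of_hasGaussianLaw (hν.hasGaussianLaw_restrict r) r.smooth

/-- Adding s to the time set makes the pair a linear image of one Gaussian vector. -/
lemma IsWienerMeasure.hasGaussianLaw_eval_inner (hν : IsWienerMeasure ν) (r : CylinderRep d)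
    (s : unitInterval) (v : E d) :
    HasGaussianLaw (fun γ : Path d => (r.eval γ, inner ℝ v (γ.1 s))) ν := by
  classical
  let L : ({t // t ∈ insert s r.times} → E d) →L[ℝ] (r.times → E d) × ℝ :=
    (ContinuousLinearMap.pi fun t =>
      ContinuousLinearMap.proj ⟨t.1, Finset.mem_insert_of_mem t.2⟩).prod
    ((innerSL ℝ v).comp (ContinuousLinearMap.proj ⟨s, Finset.mem_insert_self _ _⟩))
  exact (hν.isGaussianProcess.hasGaussianLaw (insert s r.times)).map_fun L

lemma pi_dual_apply {ι : Type*} [Fintype ι] [DecidableEq ι] (ℓ : StrongDual ℝ (ι → E d))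
    (x : ι → E d) :
    ℓ x = ∑ i, inner ℝ ((InnerProductSpace.toDual ℝ (E d)).symm
      (ℓ.comp (ContinuousLinearMap.single ℝ (fun _ : ι => E d) i))) (x i) := by
  conv_lhs => rw [← Finset.univ_sum_single x, map_sum]
  refine Finset.sum_congr rfl fun t _ => ?_
  rw [InnerProductSpace.toDual_symm_apply]
  rfl

/-- The covariance kernel min(s, t) is also the profile of the ramp. This is the covariance
hypothesis of `integral_fderiv_of_hasGaussianLaw`, with the ramp as direction. -/
lemma IsWienerMeasure.covariance_dual_eval (hν : IsWienerMeasure ν) (r : CylinderRep d)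
    (s : unitInterval) (v : E d) (ℓ : StrongDual ℝ (r.times → E d)) :
    cov[fun γ => ℓ (r.eval γ), fun γ => inner ℝ v (γ.1 s); ν]
      = ℓ (r.eval (CylinderRep.ramp s s.2.1 v)) := by
  classical
  have := hν.isProbabilityMeasure
  set w : r.times → E d := fun t => (InnerProductSpace.toDual ℝ (E d)).symm
    (ℓ.comp (ContinuousLinearMap.single ℝ (fun _ : r.times => E d) t)) with hw
  have h1 : (fun γ : Path d => ℓ (r.eval γ)) = fun γ => ∑ t, inner ℝ (w t) (γ.1 t.1) := by
    funext γ
    exact pi_dual_apply ℓ _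
  have h2 : ℓ (r.eval (CylinderRep.ramp s s.2.1 v)) = ∑ t : r.times,
      inner ℝ (w t) (min (t.1 : ℝ) s • v) := pi_dual_apply ℓ _
  rw [h1, h2, covariance_fun_sum_left (X := fun (t : r.times) (γ : Path d) =>
    inner ℝ (w t) (γ.1 t.1)) (fun t => hν.memLp_inner t.1 (w t)) (hν.memLp_inner s v)]
  refine Finset.sum_congr rfl fun t _ => ?_
  rw [inner_smul_right]
  exact hν.covariance_inner t.1 s _ v

lemma IsWienerMeasure.integral_lineDeriv_ramp (hν : IsWienerMeasure ν) {F : Path d → ℝ}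
    (hF : F ∈ cylinderFunctions d) (s : unitInterval) (v : E d) :
    ∫ γ, lineDeriv ℝ F γ (CylinderRep.ramp s s.2.1 v) ∂ν
      = ∫ γ, F γ * inner ℝ (γ.1 s) v ∂ν := by
  obtain ⟨r, rfl⟩ := hF
  have key := integral_fderiv_of_hasGaussianLaw (hν.hasGaussianLaw_eval_inner r s v)
    (hν.integral_inner s v) (hν.covariance_dual_eval r s v) r.smooth
  simp only [r.lineDeriv_eq]
  refine key.trans (integral_congr_ae (ae_of_all _ fun γ => ?_))
  simp only [CylinderRep.toFun, real_inner_comm v]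

/-- The directions in which cylindrical functions can be integrated by parts, with a divergence
that is itself a cylindrical function. -/
def HasDivergence (ν : Measure (Path d)) (h : Path d) : Prop :=
  ∃ W ∈ cylinderFunctions d, ∀ F ∈ cylinderFunctions d,
    ∫ γ, lineDeriv ℝ F γ h ∂ν = ∫ γ, F γ * W γ ∂ν

lemma IsWienerMeasure.hasDivergence_ramp (hν : IsWienerMeasure ν) (s : unitInterval) (v : E d) :
    HasDivergence ν (CylinderRep.ramp s s.2.1 v) :=
  ⟨_, inner_eval_mem s v, fun _ hF => hν.integral_lineDeriv_ramp hF s v⟩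

lemma HasDivergence.smul {h : Path d} (hh : HasDivergence ν h) (a : ℝ) :
    HasDivergence ν (a • h) := by
  obtain ⟨W, hW, H⟩ := hh
  refine ⟨_, const_mul_mem hW a, fun F hF => ?_⟩
  simp only [lineDeriv_smul, smul_eq_mul, mul_left_comm _ a, integral_const_mul, H F hF]

lemma HasDivergence.add (hν : IsWienerMeasure ν) {h k : Path d} (hh : HasDivergence ν h)
    (hk : HasDivergence ν k) : HasDivergence ν (h + k) := by
  obtain ⟨W, hW, H⟩ := hh
  obtain ⟨U, hU, H'⟩ := hk
  refine ⟨_, add_mem hW hU, fun F hF => ?_⟩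
  simp only [lineDeriv_add_dir hF, mul_add]
  rw [integral_add (hν.integrable_of_mem (lineDeriv_mem hF h))
    (hν.integrable_of_mem (lineDeriv_mem hF k)), H F hF, H' F hF,
    integral_add (hν.integrable_of_mem (mul_mem hF hW)) (hν.integrable_of_mem (mul_mem hF hU))]

/-- Integration by parts against a cylindrical test function. -/
lemma HasDivergence.exists_adjoint (hν : IsWienerMeasure ν) {h : Path d}
    (hh : HasDivergence ν h) {G : Path d → ℝ} (hG : G ∈ cylinderFunctions d) :
    ∃ K ∈ cylinderFunctions d, ∀ F ∈ cylinderFunctions d,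
      ∫ γ, lineDeriv ℝ F γ h * G γ ∂ν = ∫ γ, F γ * K γ ∂ν := by
  obtain ⟨W, hW, H⟩ := hh
  have hGW := mul_mem hG hW
  have hdG := const_mul_mem (lineDeriv_mem hG h) (-1)
  -- The adjoint of ∂_h applied to G is G W - ∂_h G, from the divergence formula for the product F
  -- G.
  refine ⟨_, add_mem hGW hdG, fun F hF => ?_⟩
  have h1 := H _ (mul_mem hF hG)
  simp only [lineDeriv_mul hF hG] at h1
  rw [integral_add (hν.integrable_of_mem (mul_mem (lineDeriv_mem hF h) hG))
    (hν.integrable_of_mem (mul_mem hF (lineDeriv_mem hG h)))] at h1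
  simp only [mul_add]
  rw [integral_add (hν.integrable_of_mem (mul_mem hF hGW))
    (hν.integrable_of_mem (mul_mem hF hdG))]
  simp only [mul_left_comm (F _) (-1 : ℝ), integral_const_mul]
  simp only [mul_assoc] at h1 ⊢
  linarith

end Wiener

/-! ### The Schauder functions -/

/-- The scalar Schauder functions `s ↦ ∫_0^s H_{r+1}`. -/
noncomputable def scalarSchauder (r : ℕ) (s : ℝ) : ℝ := ∫ u in (0 : ℝ)..s, haar r u

lemma haarLevel_eq (m k : ℕ) (t : ℝ) :
    haarLevel m k t = (2 : ℝ) ^ ((m : ℝ) / 2) *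
      ((Set.Ico (((k : ℝ) - 1) / 2 ^ m) ((2 * (k : ℝ) - 1) / 2 ^ (m + 1))).indicator 1 t
        - (Set.Ico ((2 * (k : ℝ) - 1) / 2 ^ (m + 1)) ((k : ℝ) / 2 ^ m)).indicator 1 t) := by
  unfold haarLevel
  split_ifs with h1 h2
  · have h3 : t ∉ Set.Ico ((2 * (k : ℝ) - 1) / 2 ^ (m + 1)) ((k : ℝ) / 2 ^ m) :=
      fun h => absurd h.1 (not_le.2 h1.2)
    simp only [Set.indicator_of_mem h1, Set.indicator_of_notMem h3]
    simp
  · simp only [Set.indicator_of_notMem h1, Set.indicator_of_mem h2]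
    simp
  · simp only [Set.indicator_of_notMem h1, Set.indicator_of_notMem h2]
    simp

lemma intervalIntegrable_indicator_Ico (a b s t : ℝ) :
    IntervalIntegrable ((Set.Ico a b).indicator (1 : ℝ → ℝ)) volume s t :=
  ((integrable_indicator_iff measurableSet_Ico).2
    (integrableOn_const (by simp) (by simp))).intervalIntegrable

lemma integral_indicator_Ico {a b s : ℝ} (ha : 0 ≤ a) (hab : a ≤ b) (hs : 0 ≤ s) :
    ∫ u in (0 : ℝ)..s, (Set.Ico a b).indicator (1 : ℝ → ℝ) u = min s b - min s a := by
  rw [intervalIntegral.integral_of_le hs, setIntegral_indicator measurableSet_Ico]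
  have h1 : (Set.Ioc 0 s ∩ Set.Ico a b : Set ℝ) =ᵐ[volume] (Set.Ioc 0 s ∩ Set.Ioc a b : Set ℝ) :=
    (ae_eq_refl _).inter Ico_ae_eq_Ioc
  rw [setIntegral_congr_set h1, Set.Ioc_inter_Ioc, max_eq_right ha]
  simp only [Pi.one_apply, integral_const, MeasurableSet.univ, measureReal_restrict_apply,
    Set.univ_inter, Real.volume_real_Ioc, smul_eq_mul, mul_one]
  rcases le_total s a with h | h
  · rw [min_eq_left h, min_eq_left (h.trans hab), max_eq_right (by linarith), sub_self]
  · rw [min_eq_right h, max_eq_left]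
    exact sub_nonneg.2 (le_min h hab)

lemma intervalIntegrable_haar (r : ℕ) (s t : ℝ) : IntervalIntegrable (haar r) volume s t := by
  rcases eq_or_ne r 0 with rfl | hr
  · have h : haar 0 = fun _ => 1 := by
      funext t
      simp [haar]
    rw [h]
    exact intervalIntegrable_const
  · have h : haar r = haarLevel (Nat.log 2 r) (r + 1 - 2 ^ Nat.log 2 r) := by
      funext t
      simp [haar, hr]
    rw [h, funext (haarLevel_eq _ _)]
    exact ((intervalIntegrable_indicator_Ico _ _ _ _).sub
      (intervalIntegrable_indicator_Ico _ _ _ _)).const_mul _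

lemma scalarSchauder_zero (s : ℝ) : scalarSchauder 0 s = s := by
  simp [scalarSchauder, haar]

/-- Written as a second difference of y ↦ min s y at three dyadic points, since these minima are the
coefficients of ramps. -/
lemma scalarSchauder_level {r m k : ℕ} (hm : Nat.log 2 r = m) (hk : r + 1 = 2 ^ m + k)
    (hr : r ≠ 0) {s : ℝ} (hs : 0 ≤ s) :
    scalarSchauder r s = (2 : ℝ) ^ ((m : ℝ) / 2) *
      (2 * min s ((2 * (k : ℝ) - 1) / 2 ^ (m + 1)) - min s (((k : ℝ) - 1) / 2 ^ m)
        - min s ((k : ℝ) / 2 ^ m)) := by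
  have hk1 : 1 ≤ k := by
    have := Nat.pow_log_le_self 2 hr
    rw [hm] at this
    omega
  have hk1' : (1 : ℝ) ≤ k := by exact_mod_cast hk1
  have h : haar r = haarLevel m k := by
    funext t
    have hk' : r + 1 - 2 ^ Nat.log 2 r = k := by rw [hm]; omega
    simp only [haar, if_neg hr, hk']
    rw [hm]
  have h0 : (0 : ℝ) ≤ ((k : ℝ) - 1) / 2 ^ m := div_nonneg (by linarith) (by positivity)
  have h1 : ((k : ℝ) - 1) / 2 ^ m ≤ (2 * (k : ℝ) - 1) / 2 ^ (m + 1) := by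
    rw [pow_succ, div_le_div_iff₀ (by positivity) (by positivity)]
    have : (0 : ℝ) < 2 ^ m := by positivity
    nlinarith
  have h2 : (2 * (k : ℝ) - 1) / 2 ^ (m + 1) ≤ (k : ℝ) / 2 ^ m := by
    rw [pow_succ, div_le_div_iff₀ (by positivity) (by positivity)]
    have : (0 : ℝ) < 2 ^ m := by positivity
    nlinarith
  rw [scalarSchauder, h, funext (haarLevel_eq m k), intervalIntegral.integral_const_mul,
    intervalIntegral.integral_sub (intervalIntegrable_indicator_Ico _ _ _ _)
      (intervalIntegrable_indicator_Ico _ _ _ _), integral_indicator_Ico h0 h1 hs,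
    integral_indicator_Ico (h0.trans h1) h2 hs]
  ring

/-- The graph is a tent of height 2^{m/2} / 2^{m+1}, where m is the level. The bound gives away a
factor 4. -/
lemma scalarSchauder_sq_le {r : ℕ} (hr : r ≠ 0) {s : ℝ} (hs : 0 ≤ s) :
    scalarSchauder r s ^ 2 ≤ 1 / 2 ^ Nat.log 2 r := by
  obtain ⟨k, hk⟩ : ∃ k, r + 1 = 2 ^ Nat.log 2 r + k :=
    ⟨r + 1 - 2 ^ Nat.log 2 r, by have := Nat.pow_log_le_self 2 hr; omega⟩
  generalize hm : Nat.log 2 r = m at hk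
  rw [scalarSchauder_level hm hk hr hs, mul_pow, ← Real.rpow_natCast, ← Real.rpow_mul (by simp)]
  have hP : (0 : ℝ) < 2 ^ m := by positivity
  have ha : ((k : ℝ) - 1) / 2 ^ m = (2 * (k : ℝ) - 1) / 2 ^ (m + 1) - 1 / 2 ^ m / 2 := by
    rw [pow_succ]; field_simp; ring
  have hc : (k : ℝ) / 2 ^ m = (2 * (k : ℝ) - 1) / 2 ^ (m + 1) + 1 / 2 ^ m / 2 := by
    rw [pow_succ]; field_simp; ring
  have he : (2 : ℝ) ^ ((m : ℝ) / 2 * (2 : ℕ)) = 2 ^ m := by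
    rw [show (m : ℝ) / 2 * (2 : ℕ) = m by push_cast; ring, Real.rpow_natCast]
  rw [he, ha, hc]
  have hq : (0 : ℝ) ≤ 1 / 2 ^ m := by positivity
  have hqq : (1 : ℝ) / 2 ^ m = 2 ^ m * (1 / 2 ^ m) ^ 2 := by field_simp
  generalize (2 * (k : ℝ) - 1) / 2 ^ (m + 1) = b
  generalize (1 : ℝ) / 2 ^ m = q at *
  refine le_of_le_of_eq (mul_le_mul_of_nonneg_left (c := q ^ 2) ?_ hP.le) hqq.symm
  refine sq_le_sq' ?_ ?_
  · rcases min_cases s b with h1 | h1 <;> rcases min_cases s (b - q / 2) with h2 | h2 <;>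
      rcases min_cases s (b + q / 2) with h3 | h3 <;> linarith
  · rcases min_cases s b with h1 | h1 <;> rcases min_cases s (b - q / 2) with h2 | h2 <;>
      rcases min_cases s (b + q / 2) with h3 | h3 <;> linarith

/-- At each time at most one Schauder function of each level does not vanish. -/
lemma scalarSchauder_eq_zero {r : ℕ} (hr : r ≠ 0) {s : ℝ} (hs : 0 ≤ s)
    (h : r + 1 ≠ 2 ^ Nat.log 2 r + ⌈2 ^ Nat.log 2 r * s⌉₊) : scalarSchauder r s = 0 := by
  obtain ⟨k, hk⟩ : ∃ k, r + 1 = 2 ^ Nat.log 2 r + k :=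
    ⟨r + 1 - 2 ^ Nat.log 2 r, by have := Nat.pow_log_le_self 2 hr; omega⟩
  have hkk : k ≠ ⌈2 ^ Nat.log 2 r * s⌉₊ := by
    rintro rfl
    exact h hk
  have hk0 : k ≠ 0 := by
    have := Nat.pow_log_le_self 2 hr
    omega
  generalize hm : Nat.log 2 r = m at *
  rw [scalarSchauder_level hm hk hr hs]
  have hP : (0 : ℝ) < 2 ^ m := by positivity
  have ha : ((k : ℝ) - 1) / 2 ^ m = (2 * (k : ℝ) - 1) / 2 ^ (m + 1) - 1 / 2 ^ m / 2 := by
    rw [pow_succ]; field_simp; ring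
  have hc : (k : ℝ) / 2 ^ m = (2 * (k : ℝ) - 1) / 2 ^ (m + 1) + 1 / 2 ^ m / 2 := by
    rw [pow_succ]; field_simp; ring
  have hq : (0 : ℝ) < 1 / 2 ^ m / 2 := by positivity
  -- Strictly inside the support interval, k would be the ceiling of 2^m s. Outside it the second
  -- difference vanishes.
  have hs' : s ≤ ((k : ℝ) - 1) / 2 ^ m ∨ (k : ℝ) / 2 ^ m ≤ s := by
    by_contra! hcon
    rw [div_lt_iff₀ hP, lt_div_iff₀ hP] at hcon
    refine hkk ((Nat.ceil_eq_iff hk0).2 ⟨?_, ?_⟩).symm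
    · rw [Nat.cast_sub (by omega)]
      push_cast
      linarith [hcon.1]
    · linarith [hcon.2]
  rcases hs' with h1 | h1
  · rw [min_eq_left h1, min_eq_left (by linarith), min_eq_left (by linarith)]
    ring
  · rw [min_eq_right h1, min_eq_right (by linarith), min_eq_right (by linarith), ha, hc]
    ring

section Vector

variable [NeZero d]

lemma schauder_eq (n : ℕ) (s : ℝ) :
    schauder d n s
      = scalarSchauder (n / d) s • EuclideanSpace.single (Fin.ofNat d n) (1 : ℝ) := by
  simp only [schauder, haarVec, scalarSchauder]
  rw [intervalIntegral.integral_smul_const]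

lemma intervalIntegrable_haarVec (n : ℕ) (s t : ℝ) :
    IntervalIntegrable (haarVec d n) volume s t :=
  ⟨(intervalIntegrable_haar _ s t).1.smul_const _, (intervalIntegrable_haar _ s t).2.smul_const _⟩

/-- The Schauder functions as elements of the path space. -/
noncomputable def schauderPath (d : ℕ) [NeZero d] (n : ℕ) : Path d :=
  ⟨⟨fun t => schauder d n t, (intervalIntegral.continuous_primitive
    (fun _ _ => intervalIntegrable_haarVec n _ _) 0).comp continuous_subtype_val⟩, by
    change schauder d n ((0 : unitInterval) : ℝ) = 0
    simp [schauder]⟩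

/-- A Schauder path is piecewise linear with at most three dyadic nodes a, b, c, hence a combination
of ramps; the first Haar function gives the ramp at time 1. -/
lemma hasDivergence_schauderPath {ν : Measure (Path d)} (hν : IsWienerMeasure ν) (n : ℕ) :
    HasDivergence ν (schauderPath d n) := by
  set e : E d := EuclideanSpace.single (Fin.ofNat d n) (1 : ℝ) with he
  set r := n / d with hr
  rcases eq_or_ne r 0 with hr0 | hr0
  · have h : schauderPath d n = CylinderRep.ramp ((1 : unitInterval) : ℝ)
        (1 : unitInterval).2.1 e := by
      refine Subtype.ext (ContinuousMap.ext fun t => ?_)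
      change schauder d n t = min (t : ℝ) ((1 : unitInterval) : ℝ) • e
      rw [schauder_eq, ← hr, hr0, scalarSchauder_zero, Set.Icc.coe_one, min_eq_left t.2.2]
    rw [h]
    exact hν.hasDivergence_ramp 1 e
  · obtain ⟨k, hk⟩ : ∃ k, r + 1 = 2 ^ Nat.log 2 r + k :=
      ⟨r + 1 - 2 ^ Nat.log 2 r, by have := Nat.pow_log_le_self 2 hr0; omega⟩
    have hk1 : 1 ≤ k := by have := Nat.pow_log_le_self 2 hr0; omega
    have hk2 : k ≤ 2 ^ Nat.log 2 r := by
      have := Nat.lt_pow_succ_log_self (b := 2) (by norm_num) r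
      rw [pow_succ] at this
      omega
    generalize hm : Nat.log 2 r = m at hk hk2
    have hk1' : (1 : ℝ) ≤ k := by exact_mod_cast hk1
    have hk2' : (k : ℝ) ≤ 2 ^ m := by exact_mod_cast hk2
    have hP : (0 : ℝ) < 2 ^ m := by positivity
    let a : unitInterval := ⟨((k : ℝ) - 1) / 2 ^ m,
      div_nonneg (by linarith) hP.le, (div_le_one hP).2 (by linarith)⟩
    let b : unitInterval := ⟨(2 * (k : ℝ) - 1) / 2 ^ (m + 1),
      div_nonneg (by linarith) (by positivity),
      (div_le_one (by positivity)).2 (by rw [pow_succ]; linarith)⟩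
    let c : unitInterval := ⟨(k : ℝ) / 2 ^ m, by positivity, (div_le_one hP).2 hk2'⟩
    have h : schauderPath d n = (2 : ℝ) ^ ((m : ℝ) / 2) • ((2 : ℝ) • CylinderRep.ramp b b.2.1 e
        + ((-1 : ℝ) • CylinderRep.ramp a a.2.1 e + (-1 : ℝ) • CylinderRep.ramp c c.2.1 e)) := by
      refine Subtype.ext (ContinuousMap.ext fun t => ?_)
      change schauder d n t = (2 : ℝ) ^ ((m : ℝ) / 2) • ((2 : ℝ) • (min (t : ℝ) (b : ℝ) • e)
        + ((-1 : ℝ) • (min (t : ℝ) (a : ℝ) • e) + (-1 : ℝ) • (min (t : ℝ) (c : ℝ) • e)))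
      rw [schauder_eq, ← hr, scalarSchauder_level hm hk hr0 t.2.1]
      module
    rw [h]
    exact (((hν.hasDivergence_ramp b e).smul 2).add hν
      (((hν.hasDivergence_ramp a e).smul (-1)).add hν
        ((hν.hasDivergence_ramp c e).smul (-1)))).smul _

end Vector

/-! ### The Cameron-Martin pairing as a directional derivative -/

lemma CylinderRep.inner_partialGrad (r : CylinderRep d) (γ : Path d) (t : r.times)
    (v : E d) :
    inner ℝ (r.partialGrad t (r.eval γ)) v = fderiv ℝ r.f (r.eval γ) (Pi.single t v) := by
  have hd : HasFDerivAt r.f (fderiv ℝ r.f (r.eval γ))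
      (Function.update (r.eval γ) t (r.eval γ t)) := by
    simpa using (r.smooth.1.differentiable (by simp)).differentiableAt.hasFDerivAt
  have h := hd.comp _ (hasFDerivAt_update (𝕜 := ℝ) (r.eval γ) (i := t) (r.eval γ t))
  rw [partialGrad, gradient, InnerProductSpace.toDual_symm_apply]
  refine (congrArg (fun L : E d →L[ℝ] ℝ => L v) h.fderiv).trans ?_
  simp only [ContinuousLinearMap.comp_apply]
  congr 1
  ext u
  by_cases hut : u = t
  · subst hut; simp
  · simp [hut]

lemma CylinderRep.fderiv_eq_sum (r : CylinderRep d) (γ : Path d) (x : r.times → E d) :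
    fderiv ℝ r.f (r.eval γ) x = ∑ t, inner ℝ (r.partialGrad t (r.eval γ)) (x t) := by
  conv_lhs => rw [← Finset.univ_sum_single x, map_sum]
  exact Finset.sum_congr rfl fun t _ => (r.inner_partialGrad γ t (x t)).symm

lemma CylinderRep.hasDerivAt_grad (r : CylinderRep d) (γ : Path d) {x : ℝ}
    (hx : ∀ t ∈ r.times, (t : ℝ) ≠ x) :
    HasDerivAt (r.grad γ)
      (∑ t : r.times, ({y : ℝ | y ≤ (t.1 : ℝ)}.indicator (1 : ℝ → ℝ) x)
        • r.partialGrad t (r.eval γ)) x := by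
  unfold CylinderRep.grad
  refine HasDerivAt.fun_sum fun t _ => ?_
  refine HasDerivAt.smul_const ?_ _
  rcases lt_or_gt_of_ne (hx t.1 t.2) with h | h
  · have h1 : x ∉ {y : ℝ | y ≤ (t.1 : ℝ)} := not_le.2 h
    rw [Set.indicator_of_notMem h1]
    refine (hasDerivAt_const x (t.1 : ℝ)).congr_of_eventuallyEq ?_
    filter_upwards [lt_mem_nhds h] with y hy
    exact min_eq_left hy.le
  · have h1 : x ∈ {y : ℝ | y ≤ (t.1 : ℝ)} := h.le
    rw [Set.indicator_of_mem h1]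
    refine (hasDerivAt_id x).congr_of_eventuallyEq ?_
    filter_upwards [gt_mem_nhds h] with y hy
    exact min_eq_right (le_of_lt hy)

/-- The derivative of s ↦ D_s F is the step function ∑ 1_{x ≤ t} ∇_t f. Pairing g_n with 1_{x ≤ t}
integrates it over [0, t] and returns S_n(t). -/
lemma cmInner_schauder [NeZero d] {F : Path d → ℝ} (hF : F ∈ cylinderFunctions d) (n : ℕ)
    (γ : Path d) :
    cmInner (schauder d n) (malliavinD F γ) = lineDeriv ℝ F γ (schauderPath d n) := by
  obtain ⟨r, rfl⟩ := hF
  rw [r.lineDeriv_eq, r.fderiv_eq_sum]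
  set g : r.times → E d := fun t => r.partialGrad t (r.eval γ) with hg
  have hlin : ∀ v : E d, IntervalIntegrable (fun x => inner ℝ (haarVec d n x) v) volume 0 1 := by
    intro v
    have h := intervalIntegrable_haarVec (d := d) n 0 1
    simp only [real_inner_comm v]
    exact ⟨h.1.const_inner v, h.2.const_inner v⟩
  have h1 : cmInner (schauder d n) (malliavinD r.toFun γ)
      = ∫ x in (0 : ℝ)..1, ∑ t : r.times,
        ({y : ℝ | y ≤ (t.1 : ℝ)}.indicator (fun x => inner ℝ (haarVec d n x) (g t)) x) := by
    refine intervalIntegral.integral_congr_ae ?_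
    -- The time points, where D F has kinks, form a null set.
    have hfin : ∀ᵐ x : ℝ, x ∉ (fun t : unitInterval => (t : ℝ)) '' (r.times : Set unitInterval) :=
      (r.times.finite_toSet.image _).countable.ae_notMem _
    filter_upwards [(intervalIntegrable_haarVec (d := d) n 0 1).ae_hasDerivAt_integral, hfin]
      with x hx hxt hx01
    rw [Set.uIoc_of_le zero_le_one] at hx01
    have hS : deriv (schauder d n) x = haarVec d n x :=
      (hx (by rw [Set.uIcc_of_le zero_le_one]; exact ⟨hx01.1.le, hx01.2⟩) 0 (by simp)).deriv
    -- Independence of the presentation is known only for s ≥ 0, so a neighbourhood of x > 0 inside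
    -- the half-line is needed.
    have hD : malliavinD r.toFun γ =ᶠ[𝓝 x] r.grad γ := by
      filter_upwards [lt_mem_nhds hx01.1] with y hy
      exact malliavinD_toFun r γ hy.le
    rw [hS, hD.deriv_eq, (r.hasDerivAt_grad γ fun t ht h => hxt ⟨t, ht, h⟩).deriv, inner_sum]
    refine Finset.sum_congr rfl fun t _ => ?_
    rw [inner_smul_right]
    by_cases h : x ∈ {y : ℝ | y ≤ (t.1 : ℝ)}
    · rw [Set.indicator_of_mem h, Set.indicator_of_mem h]
      simp [hg]
    · rw [Set.indicator_of_notMem h, Set.indicator_of_notMem h]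
      simp
  rw [h1, intervalIntegral.integral_finsetSum]
  · refine Finset.sum_congr rfl fun t _ => ?_
    rw [intervalIntegral.integral_indicator t.1.2]
    have hint := intervalIntegrable_haarVec (d := d) n 0 t.1
    have h2 := (innerSL ℝ (g t)).intervalIntegral_comp_comm hint
    simp only [innerSL_apply_apply, real_inner_comm] at h2 ⊢
    exact h2.trans (real_inner_comm _ _)
  · intro t _
    have h := hlin (g t)
    rw [intervalIntegrable_iff] at h ⊢
    exact h.indicator measurableSet_Iic

/-! ### The domain of the form -/

section Domain

variable {ν : Measure (Path d)} {φ : Path d → ℝ}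

lemma integrable_mul_weight (hν : IsWienerMeasure ν) (hφ_meas : Measurable φ)
    (hφ : ∃ C : ℝ, ∀ᵐ γ ∂ν, 0 < φ γ ∧ φ γ ≤ C) {F : Path d → ℝ}
    (hF : F ∈ cylinderFunctions d) : Integrable (fun γ => F γ * φ γ) ν := by
  obtain ⟨C, hC⟩ := hφ
  refine (hν.integrable_of_mem hF).mul_bdd (c := C) hφ_meas.aestronglyMeasurable ?_
  filter_upwards [hC] with γ hγ
  rw [Real.norm_of_nonneg hγ.1.le]
  exact hγ.2

variable [NeZero d]

/-- If n / d has level m, then n < 2^{m+1} d, which is at most the dyadic index with p = m + 1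
counted from zero, for any digits. -/
lemma le_dyadic_index {lam : ℕ → ℝ} (hmono : Monotone lam) (c : ℕ → ℕ) (n : ℕ) (j : Fin d) :
    lam n ≤ lam (2 ^ (Nat.log 2 (n / d) + 1) * (d + j) + ∑ q ∈ Finset.range
      (Nat.log 2 (n / d) + 1 + 1), c q * 2 ^ (Nat.log 2 (n / d) + 1 - q)) := by
  refine hmono ?_
  have hd : 0 < d := Nat.pos_of_ne_zero (NeZero.ne d)
  have h1 := Nat.lt_pow_succ_log_self (b := 2) (by norm_num) (n / d)
  have h2 : n < 2 ^ (Nat.log 2 (n / d) + 1) * d := (Nat.div_lt_iff_lt_mul hd).1 h1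
  calc n ≤ 2 ^ (Nat.log 2 (n / d) + 1) * d := h2.le
    _ ≤ 2 ^ (Nat.log 2 (n / d) + 1) * (d + j) := Nat.mul_le_mul_left _ (Nat.le_add_right _ _)
    _ ≤ _ := Nat.le_add_right _ _

/-- At a fixed s each level contributes at most one term, so the series over r is really a series
over levels. -/
lemma summable_scalarSchauder {a : ℕ → ℝ} (ha : ∀ m, 0 ≤ a m)
    (hsum : Summable fun m => a m / 2 ^ m) {s : ℝ} (hs : 0 ≤ s) (hs1 : s ≤ 1) :
    Summable fun r => a (Nat.log 2 r) * scalarSchauder r s ^ 2 := by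
  -- The term r = 0 is removed: `Nat.log 2 0 = 0` would put it on the level of r = 1, and the tent
  -- estimates do not apply to it.
  set B : ℕ → ℝ := fun r => if r = 0 then 0 else a (Nat.log 2 r) * scalarSchauder r s ^ 2 with hB
  have hBsum : Summable B := by
    rcases hs.eq_or_lt with rfl | hpos
    · have : B = 0 := by
        funext r
        simp [hB, scalarSchauder]
      rw [this]
      exact summable_zero
    -- The only index of level m whose Schauder function can be nonzero at s. The ceiling is at
    -- least 1 because s > 0.
    let ρ : ℕ → ℕ := fun m => 2 ^ m + ⌈2 ^ m * s⌉₊ - 1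
    have hceil : ∀ m, 1 ≤ ⌈2 ^ m * s⌉₊ ∧ ⌈2 ^ m * s⌉₊ ≤ 2 ^ m := by
      intro m
      refine ⟨Nat.ceil_pos.2 (by positivity), Nat.ceil_le.2 ?_⟩
      push_cast
      exact mul_le_of_le_one_right (by positivity) hs1
    have hlog : ∀ m, Nat.log 2 (ρ m) = m := by
      intro m
      obtain ⟨h1, h2⟩ := hceil m
      exact Nat.log_eq_of_pow_le_of_lt_pow (by simp only [ρ]; omega)
        (by simp only [ρ, pow_succ]; omega)
    have hρ0 : ∀ m, ρ m ≠ 0 := by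
      intro m
      have := hceil m
      have h3 : 0 < 2 ^ m := by positivity
      simp only [ρ]
      omega
    have hinj : Function.Injective ρ := fun m m' h => by
      rw [← hlog m, h, hlog m']
    have hzero : ∀ r ∉ Set.range ρ, B r = 0 := by
      intro r hr
      by_cases hr0 : r = 0
      · simp [hB, hr0]
      · have h : r + 1 ≠ 2 ^ Nat.log 2 r + ⌈2 ^ Nat.log 2 r * s⌉₊ := by
          intro h
          refine hr ⟨Nat.log 2 r, ?_⟩
          simp only [ρ]
          omega
        simp [hB, hr0, scalarSchauder_eq_zero hr0 hs h]
    rw [← hinj.summable_iff hzero]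
    refine Summable.of_nonneg_of_le (fun m => ?_) (fun m => ?_) hsum
    · simp only [Function.comp_apply, hB, if_neg (hρ0 m)]
      exact mul_nonneg (ha _) (sq_nonneg _)
    · simp only [Function.comp_apply, hB, if_neg (hρ0 m)]
      have h := scalarSchauder_sq_le (hρ0 m) hs
      rw [hlog] at h ⊢
      rw [div_eq_mul_one_div]
      exact mul_le_mul_of_nonneg_left h (ha m)
  refine (summable_congr_cofinite (g := B) ?_).2 hBsum
  filter_upwards [(Set.finite_singleton (0 : ℕ)).compl_mem_cofinite] with r hr
  have hr0 : r ≠ 0 := hr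
  simp [hB, hr0]

lemma summable_mul_scalarSchauder {lam : ℕ → ℝ} (hpos : ∀ n, 0 < lam n) (hmono : Monotone lam)
    {c : ℕ → ℕ} (hc : DyadicSummable d lam c) {s : ℝ} (hs : 0 ≤ s) (hs1 : s ≤ 1) :
    Summable fun n => lam n * scalarSchauder (n / d) s ^ 2 := by
  set a : ℕ → ℝ := fun m => lam (2 ^ (m + 1) * (d + (0 : Fin d)) + ∑ q ∈ Finset.range
    (m + 1 + 1), c q * 2 ^ (m + 1 - q)) with ha
  have ha0 : ∀ m, 0 ≤ a m := fun m => (hpos _).le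
  have hsum : Summable fun m => a m / 2 ^ m := by
    -- Level m is matched with p = m + 1, whose weight is 2^{-(m+2)}; hence the shift and the factor
    -- 4.
    have h := (((summable_nat_add_iff 1).2 (hc 0)).mul_left 4)
    refine h.congr fun m => ?_
    simp only [ha, pow_succ]
    field_simp
    norm_num
    ring
  have h1 := summable_scalarSchauder ha0 hsum hs hs1
  -- Division with remainder by d splits n into a Haar index and a coordinate, so each scalar term
  -- occurs d times.
  have h2 : Summable fun p : ℕ × Fin d =>
      a (Nat.log 2 p.1) * scalarSchauder p.1 s ^ 2 := by
    rw [summable_prod_of_nonneg fun p => mul_nonneg (ha0 _) (sq_nonneg _)]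
    refine ⟨fun r => (hasSum_fintype _).summable, ?_⟩
    simp only [tsum_const, nsmul_eq_mul]
    exact h1.mul_left _
  have h3 := (Nat.divModEquiv d).summable_iff.2 h2
  refine Summable.of_nonneg_of_le (fun n => mul_nonneg (hpos n).le (sq_nonneg _)) (fun n => ?_) h3
  simp only [Function.comp_apply, Nat.divModEquiv, Equiv.coe_fn_mk]
  exact mul_le_mul_of_nonneg_right (le_dyadic_index hmono c n 0) (sq_nonneg _)

lemma energyTerm_eq {lam : ℕ → ℝ} {F G : Path d → ℝ} (hF : F ∈ cylinderFunctions d)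
    (hG : G ∈ cylinderFunctions d) (n : ℕ) :
    energyTerm lam φ ν F G n = lam n * ∫ γ, lineDeriv ℝ F γ (schauderPath d n) *
      lineDeriv ℝ G γ (schauderPath d n) * φ γ ∂ν := by
  simp only [energyTerm, cmInner_schauder hF, cmInner_schauder hG]

theorem finiteEnergy_of_dyadicSummable (hν : IsWienerMeasure ν) (hφ_meas : Measurable φ)
    (hφ : ∃ C : ℝ, ∀ᵐ γ ∂ν, 0 < φ γ ∧ φ γ ≤ C) {lam : ℕ → ℝ} (hpos : ∀ n, 0 < lam n)
    (hmono : Monotone lam) {c : ℕ → ℕ} (hc : DyadicSummable d lam c) {F : Path d → ℝ}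
    (hF : F ∈ cylinderFunctions d) : FiniteEnergy lam φ ν F := by
  have hF' := hF
  obtain ⟨r, rfl⟩ := hF
  have hφ0 : ∀ᵐ γ ∂ν, 0 ≤ φ γ := by
    obtain ⟨C, hC⟩ := hφ
    filter_upwards [hC] with γ hγ using hγ.1.le
  let D : r.times → Fin d → Path d → ℝ := fun t j γ =>
    fderiv ℝ r.f (r.eval γ) (Pi.single t (EuclideanSpace.single j (1 : ℝ)))
  have hD : ∀ t j, D t j ∈ cylinderFunctions d := fun t j =>
    ⟨⟨r.times, r.pos, r.one_mem, _, r.smooth.fderiv_apply_const _⟩, rfl⟩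
  let A : r.times → Fin d → ℝ := fun t j => ∫ γ, D t j γ * D t j γ * φ γ ∂ν
  have hAint : ∀ t j, Integrable (fun γ => D t j γ * D t j γ * φ γ) ν := fun t j =>
    integrable_mul_weight hν hφ_meas hφ (mul_mem (hD t j) (hD t j))
  have hA0 : ∀ t j, 0 ≤ A t j := fun t j => integral_nonneg_of_ae (by
    filter_upwards [hφ0] with γ hγ using mul_nonneg (mul_self_nonneg _) hγ)
  have hlin : ∀ n γ, lineDeriv ℝ r.toFun γ (schauderPath d n)
      = ∑ t : r.times, scalarSchauder (n / d) t.1 * D t (Fin.ofNat d n) γ := by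
    intro n γ
    rw [r.lineDeriv_eq, r.fderiv_eq_sum]
    refine Finset.sum_congr rfl fun t _ => ?_
    have h1 : r.eval (schauderPath d n) t = schauder d n t.1 := rfl
    rw [h1, schauder_eq, inner_smul_right, r.inner_partialGrad]
  have hbound : ∀ n, energyTerm lam φ ν r.toFun r.toFun n ≤ ∑ t : r.times,
      (r.times.card * ∑ j, A t j) * (lam n * scalarSchauder (n / d) t.1 ^ 2) := by
    intro n
    rw [energyTerm_eq hF' hF']
    have h1 : ∫ γ, lineDeriv ℝ r.toFun γ (schauderPath d n) *
        lineDeriv ℝ r.toFun γ (schauderPath d n) * φ γ ∂ν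
        ≤ ∫ γ, ∑ t : r.times, (r.times.card * scalarSchauder (n / d) t.1 ^ 2) *
          (D t (Fin.ofNat d n) γ * D t (Fin.ofNat d n) γ * φ γ) ∂ν := by
      refine integral_mono_ae
        (integrable_mul_weight hν hφ_meas hφ (mul_mem (lineDeriv_mem hF' _) (lineDeriv_mem hF' _)))
        (integrable_finsetSum _ fun t _ => (hAint t _).const_mul _) ?_
      filter_upwards [hφ0] with γ hγ
      simp only [hlin]
      -- Cauchy–Schwarz for the finite sum over time points, at the cost of the factor
      -- `r.times.card`.
      rw [← pow_two]
      refine (mul_le_mul_of_nonneg_right sq_sum_le_card_mul_sum_sq hγ).trans_eq ?_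
      rw [Finset.mul_sum, Finset.sum_mul]
      refine Finset.sum_congr rfl fun t _ => ?_
      simp only [Finset.card_univ, Fintype.card_coe]
      ring
    refine (mul_le_mul_of_nonneg_left h1 (hpos n).le).trans ?_
    rw [integral_finsetSum _ fun t _ => (hAint t _).const_mul _, Finset.mul_sum]
    refine Finset.sum_le_sum fun t _ => ?_
    rw [integral_const_mul]
    have h2 : A t (Fin.ofNat d n) ≤ ∑ j, A t j :=
      Finset.single_le_sum (fun j _ => hA0 t j) (Finset.mem_univ _)
    have h3 : 0 ≤ lam n * (r.times.card * scalarSchauder (n / d) t.1 ^ 2) :=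
      mul_nonneg (hpos n).le (by positivity)
    calc _ = lam n * (r.times.card * scalarSchauder (n / d) t.1 ^ 2) * A t (Fin.ofNat d n) := by
          ring
      _ ≤ lam n * (r.times.card * scalarSchauder (n / d) t.1 ^ 2) * ∑ j, A t j :=
          mul_le_mul_of_nonneg_left h2 h3
      _ = _ := by ring
  refine Summable.of_nonneg_of_le (fun n => ?_) hbound
    (summable_sum fun t _ => (summable_mul_scalarSchauder hpos hmono hc t.1.2.1 t.1.2.2).mul_left _)
  rw [energyTerm_eq hF' hF']
  refine mul_nonneg (hpos n).le (integral_nonneg_of_ae ?_)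
  filter_upwards [hφ0] with γ hγ using mul_nonneg (mul_self_nonneg _) hγ

end Domain

/-! ### Cylindrical functions separate integrable functions -/

section Separation

open scoped BoundedContinuousFunction

/-- Needed for the theorem that a separating algebra of bounded continuous functions determines
finite measures. -/
instance : CompleteSpace (Path d) := by
  have h : IsClosed (pathSubmodule d : Set C(unitInterval, E d)) :=
    isClosed_eq (continuous_eval_const (0 : unitInterval)) continuous_const
  exact h.completeSpace_coe

/-- The algebra of bounded cylindrical functions. -/
noncomputable def boundedCylinder (d : ℕ) : StarSubalgebra ℝ (Path d →ᵇ ℝ) where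
  carrier := {G | ⇑G ∈ cylinderFunctions d}
  mul_mem' hF hG := mul_mem hF hG
  add_mem' hF hG := add_mem hF hG
  algebraMap_mem' a := const_mem a
  star_mem' hF := hF

/-- Distinct paths differ at some positive time; a bump function of the position at that time tells
them apart. -/
lemma separatesPoints_boundedCylinder :
    ((boundedCylinder d).map
      (BoundedContinuousFunction.toContinuousMapStarₐ ℝ)).SeparatesPoints := by
  intro γ γ' hne
  obtain ⟨t, ht⟩ : ∃ t, γ.1 t ≠ γ'.1 t := by
    by_contra! h
    exact hne (Subtype.ext (ContinuousMap.ext h))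
  have ht0 : 0 < t := by
    rcases eq_or_lt_of_le (unitInterval.nonneg' : 0 ≤ t) with rfl | h
    · simp at ht
    · exact h
  have hr : 0 < dist (γ'.1 t) (γ.1 t) := dist_pos.2 ht.symm
  let b : ContDiffBump (γ.1 t) := ⟨dist (γ'.1 t) (γ.1 t) / 2, dist (γ'.1 t) (γ.1 t),
    by positivity, by linarith⟩
  have hmem : (fun ω : Path d => b (ω.1 t)) ∈ cylinderFunctions d :=
    comp_eval_mem ht0 (b.hasCompactSupport.hasTemperateGrowth b.contDiff)
  let B : Path d →ᵇ ℝ := BoundedContinuousFunction.ofNormedAddCommGroup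
    (fun ω : Path d => b (ω.1 t)) (continuous_of_mem hmem) 1 fun ω => by
      rw [Real.norm_of_nonneg b.nonneg]
      exact b.le_one
  refine ⟨B, ⟨(BoundedContinuousFunction.toContinuousMapStarₐ ℝ) B, ⟨B, hmem, rfl⟩, rfl⟩, ?_⟩
  have h1 : B γ = 1 := b.one_of_mem_closedBall (Metric.mem_closedBall_self b.rIn_pos.le)
  have h2 : B γ' = 0 := b.zero_of_le_dist le_rfl
  rw [h1, h2]
  exact one_ne_zero

/-- The positive and negative parts of g are densities of two finite measures that agree on a
separating algebra. The measures coincide, so g⁺ = g⁻ a.e., which forces g = 0. -/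
lemma ae_eq_zero_of_integral_mul_eq_zero {ν : Measure (Path d)} [IsFiniteMeasure ν]
    {g : Path d → ℝ} (hg : Integrable g ν)
    (h : ∀ G ∈ cylinderFunctions d, (∃ B, ∀ γ, |G γ| ≤ B) → ∫ γ, g γ * G γ ∂ν = 0) :
    g =ᵐ[ν] 0 := by
  have hm : AEMeasurable g ν := hg.aemeasurable
  have hm' : AEMeasurable (fun γ => -g γ) ν := hm.neg
  have hfin : ∀ {f : Path d → ℝ}, Integrable f ν → ∫⁻ γ, ENNReal.ofReal (f γ) ∂ν ≠ ∞ :=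
    fun hf => (Integrable.lintegral_lt_top hf).ne
  have : IsFiniteMeasure (ν.withDensity fun γ => ENNReal.ofReal (g γ)) :=
    isFiniteMeasure_withDensity (hfin hg)
  have : IsFiniteMeasure (ν.withDensity fun γ => ENNReal.ofReal (-g γ)) :=
    isFiniteMeasure_withDensity (hfin hg.neg)
  have key : ν.withDensity (fun γ => ENNReal.ofReal (g γ))
      = ν.withDensity fun γ => ENNReal.ofReal (-g γ) := by
    refine ext_of_forall_mem_subalgebra_integral_eq_of_pseudoEMetric_complete_countable
      separatesPoints_boundedCylinder fun G hG => ?_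
    have hGb : ∀ γ, |G γ| ≤ ‖G‖ := fun γ => G.norm_coe_le_norm γ
    have hpos : ∀ {f : Path d → ℝ}, Integrable f ν → Integrable (fun γ => max (f γ) 0 * G γ) ν :=
      fun hf => hf.pos_part.mul_bdd (c := ‖G‖) G.continuous.aestronglyMeasurable
        (ae_of_all _ hGb)
    rw [integral_withDensity_eq_integral_toReal_smul₀ hm.ennreal_ofReal
        (ae_of_all _ fun _ => ENNReal.ofReal_lt_top),
      integral_withDensity_eq_integral_toReal_smul₀ hm'.ennreal_ofReal
        (ae_of_all _ fun _ => ENNReal.ofReal_lt_top), ← sub_eq_zero]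
    simp only [ENNReal.toReal_ofReal', smul_eq_mul]
    have hneg : Integrable (fun γ => max (-g γ) 0 * G γ) ν := hpos hg.neg
    rw [← integral_sub (hpos hg) hneg]
    refine (integral_congr_ae (ae_of_all _ fun γ => ?_)).trans (h G hG ⟨_, hGb⟩)
    simp only [← sub_mul]
    congr 1
    rcases le_total 0 (g γ) with h0 | h0
    · rw [max_eq_left h0, max_eq_right (by linarith)]; ring
    · rw [max_eq_right h0, max_eq_left (by linarith)]; ring
  have h1 := (withDensity_eq_iff hm.ennreal_ofReal hm'.ennreal_ofReal (hfin hg)).1 key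
  filter_upwards [h1] with γ hγ
  rcases le_total 0 (g γ) with h0 | h0
  · rw [ENNReal.ofReal_of_nonpos (by linarith : -g γ ≤ 0), ENNReal.ofReal_eq_zero] at hγ
    exact le_antisymm hγ h0
  · rw [ENNReal.ofReal_of_nonpos h0] at hγ
    have := ENNReal.ofReal_eq_zero.1 hγ.symm
    exact le_antisymm h0 (by simpa using this)

end Separation

/-! ### Limits of directional derivatives vanish on the zero set of the limit -/

/-- A smooth compactly supported function with derivative `1` at the origin. -/
lemma exists_smooth_cutoff : ∃ A : ℝ → ℝ, A.HasTemperateGrowth ∧ deriv A 0 = 1 ∧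
    (∃ M, ∀ x, |A x| ≤ M) ∧ (∃ M, ∀ x, |deriv A x| ≤ M) ∧ Tendsto (deriv A) (cocompact ℝ) (𝓝 0) := by
  let b : ContDiffBump (0 : ℝ) := ⟨1, 2, by norm_num, by norm_num⟩
  have hc : HasCompactSupport fun x => x * b x := b.hasCompactSupport.mul_left
  have hs : ContDiff ℝ (⊤ : ℕ∞) fun x => x * b x := contDiff_id.mul b.contDiff
  refine ⟨fun x => x * b x, hc.hasTemperateGrowth hs, ?_, ?_, ?_, ?_⟩
  · have h : (fun x => x * b x) =ᶠ[𝓝 0] id := by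
      filter_upwards [b.eventuallyEq_one] with x hx
      simp [hx]
    rw [h.deriv_eq, deriv_id]
  · exact hc.exists_bound_of_continuous hs.continuous
  · exact hc.deriv.exists_bound_of_continuous (hs.continuous_deriv (by simp))
  · have h := hasCompactSupport_iff_eventuallyEq.1 hc.deriv
    rw [coclosedCompact_eq_cocompact] at h
    exact tendsto_const_nhds.congr' (by
      filter_upwards [h] with x hx
      simpa using hx.symm)

lemma tendsto_deriv_cutoff {A : ℝ → ℝ} (h0 : deriv A 0 = 1)
    (hA : Tendsto (deriv A) (cocompact ℝ) (𝓝 0)) (x : ℝ) :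
    Tendsto (fun N : ℕ => deriv A ((N + 1 : ℝ) * x)) atTop (𝓝 (if x = 0 then 1 else 0)) := by
  split_ifs with hx
  · simp [hx, h0]
  · refine hA.comp ?_
    rw [← Metric.cobounded_eq_cocompact, ← comap_norm_atTop (E := ℝ), tendsto_comap_iff]
    have h1 : Tendsto (fun N : ℕ => (N + 1 : ℝ)) atTop atTop :=
      tendsto_atTop_add_const_right _ _ tendsto_natCast_atTop_atTop
    refine (h1.atTop_mul_const (norm_pos_iff.2 hx)).congr fun N => ?_
    simp only [Function.comp_apply, norm_mul]
    rw [Real.norm_of_nonneg (by positivity : (0 : ℝ) ≤ N + 1)]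

lemma abs_integral_mul_le_of_bounded {α : Type*} [MeasurableSpace α] {μ : Measure α}
    {f K : α → ℝ} (hK : Integrable K μ) {M : ℝ} (hf : ∀ x, |f x| ≤ M) :
    |∫ x, f x * K x ∂μ| ≤ M * ∫ x, |K x| ∂μ := by
  rw [← integral_const_mul, ← Real.norm_eq_abs]
  refine norm_integral_le_of_norm_le (hK.abs.const_mul M) (ae_of_all _ fun x => ?_)
  rw [Real.norm_eq_abs, abs_mul]
  exact mul_le_mul_of_nonneg_right (hf x) (abs_nonneg _)

/-- If `F_k → u` almost everywhere and `∂_h F_k → w` in `L¹(ν)`, then `w = 0` almost everywhere on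
`{u = 0}`. -/
lemma HasDivergence.ae_eq_zero_of_tendsto_ae {ν : Measure (Path d)} (hν : IsWienerMeasure ν)
    {h : Path d} (hh : HasDivergence ν h) {F : ℕ → Path d → ℝ}
    (hF : ∀ k, F k ∈ cylinderFunctions d) {u w : Path d → ℝ} (hu : AEStronglyMeasurable u ν)
    (hw : Integrable w ν) (hFu : ∀ᵐ γ ∂ν, Tendsto (fun k => F k γ) atTop (𝓝 (u γ)))
    (hFw : Tendsto (fun k => ∫ γ, |lineDeriv ℝ (F k) γ h - w γ| ∂ν) atTop (𝓝 0)) :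
    ∀ᵐ γ ∂ν, u γ = 0 → w γ = 0 := by
  classical
  have := hν.isProbabilityMeasure
  obtain ⟨A, hA, hA0, ⟨M, hM⟩, ⟨M', hM'⟩, hAc⟩ := exists_smooth_cutoff
  have hAd : Differentiable ℝ A := hA.1.differentiable (by simp)
  have hAdc : Continuous (deriv A) := hA.1.continuous_deriv (by simp)
  have hM'0 : 0 ≤ M' := (abs_nonneg _).trans (hM' 0)
  have hbound : ∀ {G : Path d → ℝ} {B : ℝ}, (∀ γ, |G γ| ≤ B) → ∀ {v : Path d → ℝ} (N : ℕ) (γ),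
      |deriv A ((N + 1 : ℝ) * v γ) * G γ| ≤ M' * B := by
    intro G B hB v N γ
    rw [abs_mul]
    exact mul_le_mul (hM' _) (hB γ) (abs_nonneg _) hM'0
  have hmeas : ∀ {G : Path d → ℝ}, G ∈ cylinderFunctions d → ∀ {v : Path d → ℝ},
      AEStronglyMeasurable v ν → ∀ N : ℕ,
      AEStronglyMeasurable (fun γ => deriv A ((N + 1 : ℝ) * v γ) * G γ) ν := fun hG _ hv N =>
    (hAdc.comp_aestronglyMeasurable (hv.const_mul _)).mul
      (continuous_of_mem hG).aestronglyMeasurable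
  -- Here L = ∫ |K| dν, where K is the adjoint of ∂_h applied to G; it depends on neither N nor k.
  have hstep : ∀ G ∈ cylinderFunctions d, (∃ B, ∀ γ, |G γ| ≤ B) → ∃ L : ℝ, ∀ N : ℕ,
      |∫ γ, w γ * (deriv A ((N + 1 : ℝ) * u γ) * G γ) ∂ν| ≤ M / (N + 1) * L := by
    rintro G hG ⟨B, hB⟩
    obtain ⟨K, hK, hadj⟩ := hh.exists_adjoint hν hG
    refine ⟨∫ γ, |K γ| ∂ν, fun N => ?_⟩
    have hN : (0 : ℝ) < N + 1 := by positivity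
    -- This rescaling is bounded by M / (N + 1), while its derivative A'((N + 1)x) does not shrink
    -- at 0. Using N + 1 avoids division by zero.
    have hAN : (fun x => A ((N + 1 : ℝ) * x) / (N + 1)).HasTemperateGrowth := by
      have h1 := hA.comp ((Function.HasTemperateGrowth.const (N + 1 : ℝ)).mul .id')
      have h2 := h1.mul (Function.HasTemperateGrowth.const ((N + 1 : ℝ)⁻¹))
      exact h2
    have hANd : ∀ x, deriv (fun x => A ((N + 1 : ℝ) * x) / (N + 1)) x
        = deriv A ((N + 1 : ℝ) * x) := by
      intro x
      have h1 : HasDerivAt (fun x : ℝ => (N + 1 : ℝ) * x) (N + 1) x := by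
        simpa using (hasDerivAt_id x).const_mul (N + 1 : ℝ)
      have h2 := ((hAd _).hasDerivAt.comp x h1).div_const (N + 1 : ℝ)
      rw [mul_div_cancel_right₀ _ hN.ne'] at h2
      exact h2.deriv
    have hk : ∀ k, |∫ γ, lineDeriv ℝ (F k) γ h * (deriv A ((N + 1 : ℝ) * F k γ) * G γ) ∂ν|
        ≤ M / (N + 1) * ∫ γ, |K γ| ∂ν := by
      intro k
      have h1 := hadj _ (comp_mem (hF k) hAN)
      simp only [lineDeriv_comp (hF k) (hAN.1.differentiable (by simp)), hANd] at h1
      have h2 : ∫ γ, lineDeriv ℝ (F k) γ h * (deriv A ((N + 1 : ℝ) * F k γ) * G γ) ∂ν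
          = ∫ γ, A ((N + 1 : ℝ) * F k γ) / (N + 1) * K γ ∂ν := by
        rw [← h1]
        refine integral_congr_ae (ae_of_all _ fun γ => ?_)
        simp only
        ring
      rw [h2]
      refine abs_integral_mul_le_of_bounded (hν.integrable_of_mem hK) fun γ => ?_
      rw [abs_div, abs_of_pos hN]
      gcongr
      exact hM _
    suffices hconv : Tendsto (fun k => ∫ γ, lineDeriv ℝ (F k) γ h *
        (deriv A ((N + 1 : ℝ) * F k γ) * G γ) ∂ν) atTop
        (𝓝 (∫ γ, w γ * (deriv A ((N + 1 : ℝ) * u γ) * G γ) ∂ν)) from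
      le_of_tendsto hconv.abs (Eventually.of_forall hk)
    have hdF : ∀ k, Integrable (fun γ => lineDeriv ℝ (F k) γ h - w γ) ν := fun k =>
      (hν.integrable_of_mem (lineDeriv_mem (hF k) h)).sub hw
    have hFm : ∀ k, AEStronglyMeasurable (F k) ν := fun k =>
      (continuous_of_mem (hF k)).aestronglyMeasurable
    have hsplit : ∀ k, ∫ γ, lineDeriv ℝ (F k) γ h * (deriv A ((N + 1 : ℝ) * F k γ) * G γ) ∂ν
        = (∫ γ, (deriv A ((N + 1 : ℝ) * F k γ) * G γ) * (lineDeriv ℝ (F k) γ h - w γ) ∂ν)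
          + ∫ γ, w γ * (deriv A ((N + 1 : ℝ) * F k γ) * G γ) ∂ν := by
      intro k
      rw [← integral_add ((hdF k).bdd_mul (c := M' * B) (hmeas hG (hFm k) N)
          (ae_of_all _ (hbound hB N)))
        (hw.mul_bdd (c := M' * B) (hmeas hG (hFm k) N) (ae_of_all _ (hbound hB N)))]
      refine integral_congr_ae (ae_of_all _ fun γ => ?_)
      simp only
      ring
    simp only [hsplit]
    rw [← zero_add (∫ γ, w γ * (deriv A ((N + 1 : ℝ) * u γ) * G γ) ∂ν)]
    -- The first part is a bounded factor times an L¹-null sequence. The second converges by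
    -- domination by |w| M' B, as A' is continuous and F_k → u a.e.
    refine Tendsto.add ?_ ?_
    · refine squeeze_zero_norm (a := fun k => M' * B * ∫ γ, |lineDeriv ℝ (F k) γ h - w γ| ∂ν)
        (fun k => abs_integral_mul_le_of_bounded (hdF k) (hbound hB N)) ?_
      simpa using hFw.const_mul (M' * B)
    · refine tendsto_integral_of_dominated_convergence (fun γ => |w γ| * (M' * B))
        (fun k => hw.1.mul (hmeas hG (hFm k) N)) (hw.abs.mul_const _)
        (fun k => ae_of_all _ fun γ => ?_) ?_
      · rw [norm_mul]
        exact mul_le_mul_of_nonneg_left (hbound hB N γ) (abs_nonneg _)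
      · filter_upwards [hFu] with γ hγ
        exact (((hAdc.tendsto _).comp (hγ.const_mul _)).mul_const _).const_mul _
  have hind : Integrable (fun γ => w γ * if u γ = 0 then 1 else 0) ν := by
    refine hw.mul_bdd (c := 1) ?_ (ae_of_all _ fun γ => by split_ifs <;> simp)
    have hms : NullMeasurableSet {γ | u γ = 0} ν :=
      hu.aemeasurable.nullMeasurable (measurableSet_singleton (0 : ℝ))
    have h1 := (aestronglyMeasurable_const (b := (1 : ℝ)) (μ := ν)).indicator₀ hms
    refine h1.congr (ae_of_all _ fun γ => ?_)
    simp [Set.indicator_apply]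
  have hzero := ae_eq_zero_of_integral_mul_eq_zero hind fun G hG hGb => ?_
  · filter_upwards [hzero] with γ hγ hu0
    simpa [hu0] using hγ
  obtain ⟨L, hL⟩ := hstep G hG hGb
  obtain ⟨B, hB⟩ := hGb
  -- As N → ∞ the factor A'((N + 1)u) tends to the indicator of {u = 0}, while `hstep` sends the
  -- same integrals to 0.
  have hlim : Tendsto (fun N : ℕ => ∫ γ, w γ * (deriv A ((N + 1 : ℝ) * u γ) * G γ) ∂ν) atTop
      (𝓝 (∫ γ, (w γ * if u γ = 0 then 1 else 0) * G γ ∂ν)) := by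
    refine tendsto_integral_of_dominated_convergence (fun γ => |w γ| * (M' * B))
      (fun N => hw.1.mul (hmeas hG hu N)) (hw.abs.mul_const _)
      (fun N => ae_of_all _ fun γ => ?_) (ae_of_all _ fun γ => ?_)
    · rw [norm_mul]
      exact mul_le_mul_of_nonneg_left (hbound hB N γ) (abs_nonneg _)
    · have h1 := ((tendsto_deriv_cutoff hA0 hAc (u γ)).mul_const (G γ)).const_mul (w γ)
      simpa only [mul_assoc] using h1
  have hlim0 : Tendsto (fun N : ℕ => ∫ γ, w γ * (deriv A ((N + 1 : ℝ) * u γ) * G γ) ∂ν) atTop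
      (𝓝 0) := by
    refine squeeze_zero_norm hL ?_
    have h1 : Tendsto (fun N : ℕ => M / (N + 1 : ℝ)) atTop (𝓝 0) :=
      tendsto_const_nhds.div_atTop
        (tendsto_atTop_add_const_right _ _ tendsto_natCast_atTop_atTop)
    simpa using h1.mul_const L
  exact tendsto_nhds_unique hlim hlim0

/-! ### The weighted measure -/

section Weighted

variable {ν : Measure (Path d)} {φ : Path d → ℝ}

lemma absolutelyContinuous_weighted (hφ_meas : Measurable φ)
    (hφ : ∃ C : ℝ, ∀ᵐ γ ∂ν, 0 < φ γ ∧ φ γ ≤ C) : ν ≪ weighted φ ν := by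
  obtain ⟨C, hC⟩ := hφ
  refine withDensity_absolutelyContinuous' hφ_meas.ennreal_ofReal.aemeasurable ?_
  filter_upwards [hC] with γ hγ
  exact (ENNReal.ofReal_pos.2 hγ.1).ne'

lemma weighted_absolutelyContinuous : weighted φ ν ≪ ν :=
  withDensity_absolutelyContinuous _ _

lemma integral_weighted (hφ_meas : Measurable φ) (hφ : ∃ C : ℝ, ∀ᵐ γ ∂ν, 0 < φ γ ∧ φ γ ≤ C)
    (g : Path d → ℝ) : ∫ γ, g γ ∂weighted φ ν = ∫ γ, g γ * φ γ ∂ν := by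
  obtain ⟨C, hC⟩ := hφ
  rw [weighted, integral_withDensity_eq_integral_toReal_smul hφ_meas.ennreal_ofReal
    (ae_of_all _ fun _ => ENNReal.ofReal_lt_top)]
  refine integral_congr_ae ?_
  filter_upwards [hC] with γ hγ
  rw [ENNReal.toReal_ofReal hγ.1.le, smul_eq_mul, mul_comm]

lemma memLp_weighted (hν : IsWienerMeasure ν) (hφ_meas : Measurable φ)
    (hφ : ∃ C : ℝ, ∀ᵐ γ ∂ν, 0 < φ γ ∧ φ γ ≤ C) {F : Path d → ℝ}
    (hF : F ∈ cylinderFunctions d) : MemLp F 2 (weighted φ ν) := by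
  rw [memLp_two_iff_integrable_sq (continuous_of_mem hF).aestronglyMeasurable, weighted,
    integrable_withDensity_iff_integrable_smul₀' hφ_meas.ennreal_ofReal.aemeasurable
      (ae_of_all _ fun _ => ENNReal.ofReal_lt_top)]
  refine (integrable_mul_weight hν hφ_meas hφ (mul_mem hF hF)).congr ?_
  obtain ⟨C, hC⟩ := hφ
  filter_upwards [hC] with γ hγ
  rw [ENNReal.toReal_ofReal hγ.1.le, smul_eq_mul]
  ring

/-- Since `1 / φ` is integrable, `L²(φ ν)` embeds continuously into `L¹(ν)`. -/
lemma exists_eLpNorm_one_le (hφ_meas : Measurable φ)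
    (hφ : ∃ C : ℝ, ∀ᵐ γ ∂ν, 0 < φ γ ∧ φ γ ≤ C) (hint : Integrable (fun γ => 1 / φ γ) ν) :
    ∃ C : ℝ≥0∞, C ≠ ∞ ∧ ∀ f : Path d → ℝ, AEStronglyMeasurable f ν →
      eLpNorm f 1 ν ≤ eLpNorm f 2 (weighted φ ν) * C := by
  have hw : Measurable fun γ => ENNReal.ofReal (φ γ) := hφ_meas.ennreal_ofReal
  have hpos : ∀ᵐ γ ∂ν, 0 < φ γ := by
    obtain ⟨C, hC⟩ := hφ
    filter_upwards [hC] with γ hγ using hγ.1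
  refine ⟨(∫⁻ γ, (ENNReal.ofReal (φ γ))⁻¹ ∂ν) ^ (1 / 2 : ℝ), ?_, fun f hf => ?_⟩
  · refine ENNReal.rpow_ne_top_of_nonneg (by norm_num) ?_
    have h1 : ∫⁻ γ, (ENNReal.ofReal (φ γ))⁻¹ ∂ν = ∫⁻ γ, ENNReal.ofReal (1 / φ γ) ∂ν := by
      refine lintegral_congr_ae ?_
      filter_upwards [hpos] with γ hγ
      rw [one_div, ENNReal.ofReal_inv_of_pos hγ]
    rw [h1]
    exact (Integrable.lintegral_lt_top hint).ne
  · have hfe : AEMeasurable (fun γ => ‖f γ‖ₑ) ν := hf.enorm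
    -- Cauchy–Schwarz for |f| = (|f| φ^{1/2}) φ^{-1/2}; the constant is the L²(ν) norm of φ^{-1/2}.
    have h1 : eLpNorm f 1 ν = ∫⁻ γ, ((fun γ => ‖f γ‖ₑ * ENNReal.ofReal (φ γ) ^ (1 / 2 : ℝ)) *
        fun γ => (ENNReal.ofReal (φ γ))⁻¹ ^ (1 / 2 : ℝ)) γ ∂ν := by
      rw [eLpNorm_one_eq_lintegral_enorm]
      refine lintegral_congr_ae ?_
      filter_upwards [hpos] with γ hγ
      simp only [Pi.mul_apply]
      rw [mul_assoc, ← ENNReal.mul_rpow_of_nonneg _ _ (by norm_num : (0 : ℝ) ≤ 1 / 2),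
        ENNReal.mul_inv_cancel (ENNReal.ofReal_pos.2 hγ).ne' ENNReal.ofReal_ne_top,
        ENNReal.one_rpow, mul_one]
    have hhalf : ∀ x : ℝ≥0∞, (x ^ (1 / 2 : ℝ)) ^ (2 : ℝ) = x := fun x => by
      rw [← ENNReal.rpow_mul]
      norm_num
    rw [h1]
    refine (ENNReal.lintegral_mul_le_Lp_mul_Lq ν Real.HolderConjugate.two_two
      (hfe.mul (hw.pow_const _).aemeasurable) (hw.inv.pow_const _).aemeasurable).trans_eq ?_
    simp only [hhalf]
    congr 1
    rw [eLpNorm_eq_lintegral_rpow_enorm_toReal (by norm_num) (by norm_num), weighted,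
      lintegral_withDensity_eq_lintegral_mul₀ hw.aemeasurable (by
        simpa using hfe.pow_const (2 : ℝ))]
    simp only [ENNReal.toReal_ofNat, Pi.mul_apply]
    congr 1
    refine lintegral_congr fun γ => ?_
    rw [ENNReal.mul_rpow_of_nonneg _ _ (by norm_num : (0 : ℝ) ≤ 2), hhalf, mul_comm]

/-- If `F_k → u` and `∂_h F_k → w` in `L²(φ ν)`, then `w = 0` almost everywhere on `{u = 0}`. -/
lemma HasDivergence.ae_eq_zero_of_tendsto_eLpNorm (hν : IsWienerMeasure ν)
    (hφ_meas : Measurable φ) (hφ : ∃ C : ℝ, ∀ᵐ γ ∂ν, 0 < φ γ ∧ φ γ ≤ C)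
    (hint : Integrable (fun γ => 1 / φ γ) ν) {h : Path d} (hh : HasDivergence ν h)
    {F : ℕ → Path d → ℝ} (hF : ∀ k, F k ∈ cylinderFunctions d) {u w : Path d → ℝ}
    (hu : AEStronglyMeasurable u (weighted φ ν)) (hw : MemLp w 2 (weighted φ ν))
    (hFu : Tendsto (fun k => eLpNorm (F k - u) 2 (weighted φ ν)) atTop (𝓝 0))
    (hFw : Tendsto (fun k => eLpNorm ((fun γ => lineDeriv ℝ (F k) γ h) - w) 2 (weighted φ ν))
      atTop (𝓝 0)) :
    ∀ᵐ γ ∂weighted φ ν, u γ = 0 → w γ = 0 := by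
  have hac := absolutelyContinuous_weighted hφ_meas hφ
  obtain ⟨C, hC, hle⟩ := exists_eLpNorm_one_le hφ_meas hφ hint
  have hu' : AEStronglyMeasurable u ν := hu.mono_ac hac
  have hw' : AEStronglyMeasurable w ν := hw.1.mono_ac hac
  have hwint : Integrable w ν := by
    rw [← memLp_one_iff_integrable]
    exact ⟨hw', (hle w hw').trans_lt (ENNReal.mul_lt_top hw.2 hC.lt_top)⟩
  have hL1 : ∀ {f : ℕ → Path d → ℝ}, (∀ k, AEStronglyMeasurable (f k) ν) →
      Tendsto (fun k => eLpNorm (f k) 2 (weighted φ ν)) atTop (𝓝 0) →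
      Tendsto (fun k => eLpNorm (f k) 1 ν) atTop (𝓝 0) := by
    intro f hf hlim
    refine tendsto_of_tendsto_of_tendsto_of_le_of_le tendsto_const_nhds ?_
      (fun _ => bot_le) fun k => hle (f k) (hf k)
    simpa using ENNReal.Tendsto.mul_const hlim (Or.inr hC)
  have hFm : ∀ k, AEStronglyMeasurable (F k) ν := fun k =>
    (continuous_of_mem (hF k)).aestronglyMeasurable
  have hdm : ∀ k, AEStronglyMeasurable ((fun γ => lineDeriv ℝ (F k) γ h) - w) ν := fun k =>
    (continuous_of_mem (lineDeriv_mem (hF k) h)).aestronglyMeasurable.sub hw'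
  obtain ⟨ns, hns, hae⟩ := (tendstoInMeasure_of_tendsto_eLpNorm one_ne_zero hFm hu'
    (hL1 (fun k => (hFm k).sub hu') hFu)).exists_seq_tendsto_ae
  have hint1 : Tendsto (fun k => ∫ γ, |lineDeriv ℝ (F (ns k)) γ h - w γ| ∂ν) atTop (𝓝 0) := by
    have h1 := (ENNReal.tendsto_toReal ENNReal.zero_ne_top).comp
      ((hL1 hdm hFw).comp hns.tendsto_atTop)
    rw [ENNReal.toReal_zero] at h1
    refine h1.congr fun k => ?_
    simp only [Function.comp_apply]
    rw [eLpNorm_one_eq_lintegral_enorm, ← integral_norm_eq_lintegral_enorm (hdm (ns k))]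
    rfl
  exact weighted_absolutelyContinuous.ae_le (hh.ae_eq_zero_of_tendsto_ae hν
    (fun k => hF (ns k)) hu' hwint hae hint1)

end Weighted

/-! ### The form as an inner product -/

/-- A measure is carried by its topological support. This turns disjointness of supports into a
pointwise a.e. statement. -/
lemma ae_mem_l2Support {μ : Measure (Path d)} (u : Lp ℝ 2 μ) :
    ∀ᵐ γ ∂μ, u γ ≠ 0 → γ ∈ l2Support u := by
  have h : ∀ᵐ γ ∂(μ.withDensity fun x => ‖u x‖ₑ), γ ∈ l2Support u := Measure.support_mem_ae
  rw [ae_withDensity_iff' (Lp.aestronglyMeasurable u).enorm] at h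
  filter_upwards [h] with γ hγ h0
  exact hγ (by simpa using h0)

section Embedding

variable [NeZero d] {ν : Measure (Path d)} {φ : Path d → ℝ} {lam : ℕ → ℝ}

/-- The direction `√λ_n S_n`. -/
noncomputable def direction (d : ℕ) [NeZero d] (lam : ℕ → ℝ) (n : ℕ) : Path d :=
  √(lam n) • schauderPath d n

lemma hasDivergence_direction (hν : IsWienerMeasure ν) (n : ℕ) :
    HasDivergence ν (direction d lam n) :=
  (hasDivergence_schauderPath hν n).smul _

open Classical in
/-- The derivative of `F` in the direction `√λ_n S_n`, as an element of `L²(φ ν)`. -/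
noncomputable def dirL2 (lam : ℕ → ℝ) (φ : Path d → ℝ) (ν : Measure (Path d)) (F : Path d → ℝ)
    (n : ℕ) : Lp ℝ 2 (weighted φ ν) :=
  if h : MemLp (fun γ => lineDeriv ℝ F γ (direction d lam n)) 2 (weighted φ ν) then h.toLp else 0

open Classical in
/-- The sequence of the derivatives of `F` in the directions `√λ_n S_n`. -/
noncomputable def energyVec (lam : ℕ → ℝ) (φ : Path d → ℝ) (ν : Measure (Path d))
    (F : Path d → ℝ) : lp (fun _ : ℕ => Lp ℝ 2 (weighted φ ν)) 2 :=
  if h : Memℓp (dirL2 lam φ ν F) 2 then ⟨dirL2 lam φ ν F, h⟩ else 0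

variable (hν : IsWienerMeasure ν) (hφ_meas : Measurable φ)
  (hφ : ∃ C : ℝ, ∀ᵐ γ ∂ν, 0 < φ γ ∧ φ γ ≤ C) (hlam : ∀ n, 0 < lam n)

include hν hφ_meas hφ

lemma coeFn_dirL2 {F : Path d → ℝ} (hF : F ∈ cylinderFunctions d) (n : ℕ) :
    dirL2 lam φ ν F n =ᵐ[weighted φ ν] fun γ => lineDeriv ℝ F γ (direction d lam n) := by
  rw [dirL2, dif_pos (memLp_weighted hν hφ_meas hφ (lineDeriv_mem hF _))]
  exact MemLp.coeFn_toLp _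

lemma dirL2_sub {F G : Path d → ℝ} (hF : F ∈ cylinderFunctions d)
    (hG : G ∈ cylinderFunctions d) : dirL2 lam φ ν (F - G) = dirL2 lam φ ν F - dirL2 lam φ ν G := by
  funext n
  refine Lp.ext ?_
  rw [Pi.sub_apply]
  filter_upwards [coeFn_dirL2 (lam := lam) hν hφ_meas hφ (sub_mem_cylinderFunctions hF hG) n,
    coeFn_dirL2 (lam := lam) hν hφ_meas hφ hF n, coeFn_dirL2 (lam := lam) hν hφ_meas hφ hG n,
    Lp.coeFn_sub (dirL2 lam φ ν F n) (dirL2 lam φ ν G n)] with γ h1 h2 h3 h4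
  rw [h1, h4, Pi.sub_apply, h2, h3, lineDeriv_sub hF hG]

include hlam

lemma inner_dirL2 {F G : Path d → ℝ} (hF : F ∈ cylinderFunctions d)
    (hG : G ∈ cylinderFunctions d) (n : ℕ) :
    inner ℝ (dirL2 lam φ ν F n) (dirL2 lam φ ν G n) = energyTerm lam φ ν F G n := by
  rw [L2.inner_def, energyTerm_eq hF hG, ← integral_weighted hφ_meas hφ, ← integral_const_mul]
  refine integral_congr_ae ?_
  filter_upwards [coeFn_dirL2 (lam := lam) hν hφ_meas hφ hF n,
    coeFn_dirL2 (lam := lam) hν hφ_meas hφ hG n] with γ h1 h2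
  rw [h1, h2, direction, lineDeriv_smul, lineDeriv_smul]
  simp only [smul_eq_mul, RCLike.inner_apply, conj_trivial]
  conv_rhs => rw [← Real.mul_self_sqrt (hlam n).le]
  ring

lemma memℓp_dirL2_iff {F : Path d → ℝ} (hF : F ∈ cylinderFunctions d) :
    Memℓp (dirL2 lam φ ν F) 2 ↔ FiniteEnergy lam φ ν F := by
  rw [memℓp_gen_iff (by norm_num), FiniteEnergy]
  refine summable_congr fun n => ?_
  rw [← inner_dirL2 hν hφ_meas hφ hlam hF hF n, real_inner_self_eq_norm_sq]
  norm_num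

lemma coe_energyVec {F : Path d → ℝ} (hF : F ∈ (wienerForm lam φ ν).dom) (n : ℕ) :
    energyVec lam φ ν F n = dirL2 lam φ ν F n := by
  rw [energyVec, dif_pos ((memℓp_dirL2_iff hν hφ_meas hφ hlam hF.1).2 hF.2)]

/-- Finite energy is membership in ℓ², which is a vector space. -/
lemma sub_mem_dom {F G : Path d → ℝ} (hF : F ∈ (wienerForm lam φ ν).dom)
    (hG : G ∈ (wienerForm lam φ ν).dom) : F - G ∈ (wienerForm lam φ ν).dom := by
  refine ⟨sub_mem_cylinderFunctions hF.1 hG.1, ?_⟩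
  rw [← memℓp_dirL2_iff hν hφ_meas hφ hlam (sub_mem_cylinderFunctions hF.1 hG.1),
    dirL2_sub hν hφ_meas hφ hF.1 hG.1]
  exact ((memℓp_dirL2_iff hν hφ_meas hφ hlam hF.1).2 hF.2).sub
    ((memℓp_dirL2_iff hν hφ_meas hφ hlam hG.1).2 hG.2)

lemma energyVec_sub {F G : Path d → ℝ} (hF : F ∈ (wienerForm lam φ ν).dom)
    (hG : G ∈ (wienerForm lam φ ν).dom) :
    energyVec lam φ ν (F - G) = energyVec lam φ ν F - energyVec lam φ ν G := by
  refine lp.ext (funext fun n => ?_)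
  rw [lp.coeFn_sub, Pi.sub_apply,
    coe_energyVec hν hφ_meas hφ hlam (sub_mem_dom hν hφ_meas hφ hlam hF hG),
    coe_energyVec hν hφ_meas hφ hlam hF, coe_energyVec hν hφ_meas hφ hlam hG,
    dirL2_sub hν hφ_meas hφ hF.1 hG.1, Pi.sub_apply]

lemma form_eq_inner {F G : Path d → ℝ} (hF : F ∈ (wienerForm lam φ ν).dom)
    (hG : G ∈ (wienerForm lam φ ν).dom) :
    (wienerForm lam φ ν).form F G = inner ℝ (energyVec lam φ ν F) (energyVec lam φ ν G) := by
  rw [lp.inner_eq_tsum]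
  refine tsum_congr fun n => ?_
  rw [coe_energyVec hν hφ_meas hφ hlam hF, coe_energyVec hν hφ_meas hφ hlam hG,
    inner_dirL2 hν hφ_meas hφ hlam hF.1 hG.1]

lemma form_sub_self {F G : Path d → ℝ} (hF : F ∈ (wienerForm lam φ ν).dom)
    (hG : G ∈ (wienerForm lam φ ν).dom) :
    (wienerForm lam φ ν).form (F - G) (F - G)
      = dist (energyVec lam φ ν F) (energyVec lam φ ν G) ^ 2 := by
  have h := sub_mem_dom hν hφ_meas hφ hlam hF hG
  rw [form_eq_inner hν hφ_meas hφ hlam h h, energyVec_sub hν hφ_meas hφ hlam hF hG,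
    real_inner_self_eq_norm_sq, dist_eq_norm]

/-- Form-Cauchy sequences are those whose derivatives converge. -/
lemma IsFormCauchy.exists_tendsto {F : ℕ → Path d → ℝ}
    (hF : ∀ k, F k ∈ (wienerForm lam φ ν).dom) (hc : (wienerForm lam φ ν).IsFormCauchy F) :
    ∃ ξ, Tendsto (fun k => energyVec lam φ ν (F k)) atTop (𝓝 ξ) := by
  refine cauchySeq_tendsto_of_complete ?_
  rw [cauchySeq_iff_tendsto_dist_atTop_0]
  have h1 := hc
  unfold FunctionForm.IsFormCauchy at h1
  simp only [form_sub_self hν hφ_meas hφ hlam (hF _) (hF _)] at h1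
  have h2 := h1.sqrt
  simpa only [Real.sqrt_sq dist_nonneg, Real.sqrt_zero] using h2

variable (hint : Integrable (fun γ => 1 / φ γ) ν)

include hint

/-- Coordinate projections of ℓ² are contractions, so each directional derivative converges in
L²(φν) and the statement for a single direction applies. -/
lemma ae_eq_zero_of_tendsto_energyVec {F : ℕ → Path d → ℝ}
    (hF : ∀ k, F k ∈ (wienerForm lam φ ν).dom) {u : Path d → ℝ}
    (hu : AEStronglyMeasurable u (weighted φ ν))
    (hFu : Tendsto (fun k => eLpNorm (F k - u) 2 (weighted φ ν)) atTop (𝓝 0))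
    {ξ : lp (fun _ : ℕ => Lp ℝ 2 (weighted φ ν)) 2}
    (hξ : Tendsto (fun k => energyVec lam φ ν (F k)) atTop (𝓝 ξ)) (n : ℕ) :
    ∀ᵐ γ ∂weighted φ ν, u γ = 0 → ξ n γ = 0 := by
  refine (hasDivergence_direction (lam := lam) hν n).ae_eq_zero_of_tendsto_eLpNorm hν hφ_meas hφ
    hint (fun k => (hF k).1) hu (Lp.memLp (ξ n)) hFu ?_
  have h1 : Tendsto (fun k => energyVec lam φ ν (F k) n) atTop (𝓝 (ξ n)) := by
    rw [tendsto_iff_dist_tendsto_zero] at hξ ⊢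
    refine squeeze_zero (fun _ => dist_nonneg) (fun k => ?_) hξ
    rw [dist_eq_norm, dist_eq_norm]
    exact lp.norm_apply_le_norm two_ne_zero (energyVec lam φ ν (F k) - ξ) n
  rw [Lp.tendsto_Lp_iff_tendsto_eLpNorm'] at h1
  refine h1.congr fun k => eLpNorm_congr_ae ?_
  rw [coe_energyVec hν hφ_meas hφ hlam (hF k)]
  exact (coeFn_dirL2 hν hφ_meas hφ (hF k).1 n).sub EventuallyEq.rfl

/-- For u = 0 the zero set is the whole space. -/
lemma eq_zero_of_tendsto_energyVec {F : ℕ → Path d → ℝ}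
    (hF : ∀ k, F k ∈ (wienerForm lam φ ν).dom)
    (hF0 : Tendsto (fun k => eLpNorm (F k) 2 (weighted φ ν)) atTop (𝓝 0))
    {ξ : lp (fun _ : ℕ => Lp ℝ 2 (weighted φ ν)) 2}
    (hξ : Tendsto (fun k => energyVec lam φ ν (F k)) atTop (𝓝 ξ)) : ξ = 0 := by
  refine lp.ext (funext fun n => Lp.ext ?_)
  have h1 := ae_eq_zero_of_tendsto_energyVec hν hφ_meas hφ hlam hint hF (u := 0)
    aestronglyMeasurable_zero (by simpa using hF0) hξ n
  rw [lp.coeFn_zero, Pi.zero_apply]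
  filter_upwards [h1, Lp.coeFn_zero ℝ 2 (weighted φ ν)] with γ h2 h3
  rw [h2 rfl, h3, Pi.zero_apply]

theorem isClosable_wienerForm : (wienerForm lam φ ν).IsClosable (weighted φ ν) := by
  intro F hF hF0 hc
  obtain ⟨ξ, hξ⟩ := IsFormCauchy.exists_tendsto hν hφ_meas hφ hlam hF hc
  have h0 := eq_zero_of_tendsto_energyVec hν hφ_meas hφ hlam hint hF hF0 hξ
  subst h0
  simp only [form_eq_inner hν hφ_meas hφ hlam (hF _) (hF _)]
  simpa using hξ.inner hξ (𝕜 := ℝ)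

/-- The limit of the derivatives only depends on the limit in `L²(φ ν)`. -/
lemma limit_energyVec_unique {F F' : ℕ → Path d → ℝ} {u : Lp ℝ 2 (weighted φ ν)}
    (hF : (wienerForm lam φ ν).Approximates F u) (hF' : (wienerForm lam φ ν).Approximates F' u)
    {ξ ξ' : lp (fun _ : ℕ => Lp ℝ 2 (weighted φ ν)) 2}
    (hξ : Tendsto (fun k => energyVec lam φ ν (F k)) atTop (𝓝 ξ))
    (hξ' : Tendsto (fun k => energyVec lam φ ν (F' k)) atTop (𝓝 ξ')) : ξ = ξ' := by
  rw [← sub_eq_zero]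
  refine eq_zero_of_tendsto_energyVec hν hφ_meas hφ hlam hint (F := fun k => F k - F' k)
    (fun k => sub_mem_dom hν hφ_meas hφ hlam (hF.1 k) (hF'.1 k)) ?_ ?_
  · have hm : ∀ {F : ℕ → Path d → ℝ}, (∀ k, F k ∈ (wienerForm lam φ ν).dom) → ∀ k,
        AEStronglyMeasurable (F k - (u : Path d → ℝ)) (weighted φ ν) := fun h k =>
      (continuous_of_mem (h k).1).aestronglyMeasurable.sub (Lp.aestronglyMeasurable u)
    refine tendsto_of_tendsto_of_tendsto_of_le_of_le tendsto_const_nhds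
      (by simpa using hF.2.1.add hF'.2.1) (fun _ => bot_le) fun k => ?_
    have h1 : F k - F' k = (F k - (u : Path d → ℝ)) - (F' k - (u : Path d → ℝ)) := by abel
    simp only
    rw [h1]
    exact eLpNorm_sub_le (hm hF.1 k) (hm hF'.1 k) (by norm_num)
  · simp only [energyVec_sub hν hφ_meas hφ hlam (hF.1 _) (hF'.1 _)]
    exact hξ.sub hξ'

/-- The closure is defined through chosen approximating sequences; uniqueness of the limit vectors
removes the choice. -/
lemma closure_form_eq {F G : ℕ → Path d → ℝ} {u v : Lp ℝ 2 (weighted φ ν)}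
    (hF : (wienerForm lam φ ν).Approximates F u) (hG : (wienerForm lam φ ν).Approximates G v)
    {ξ η : lp (fun _ : ℕ => Lp ℝ 2 (weighted φ ν)) 2}
    (hξ : Tendsto (fun k => energyVec lam φ ν (F k)) atTop (𝓝 ξ))
    (hη : Tendsto (fun k => energyVec lam φ ν (G k)) atTop (𝓝 η)) :
    ((wienerForm lam φ ν).closure (weighted φ ν)).form u v = inner ℝ ξ η := by
  have h : (∃ F, (wienerForm lam φ ν).Approximates F u) ∧
      ∃ G, (wienerForm lam φ ν).Approximates G v := ⟨⟨F, hF⟩, G, hG⟩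
  have hF' := Classical.choose_spec h.1
  have hG' := Classical.choose_spec h.2
  obtain ⟨ξ', hξ'⟩ := IsFormCauchy.exists_tendsto hν hφ_meas hφ hlam hF'.1 hF'.2.2
  obtain ⟨η', hη'⟩ := IsFormCauchy.exists_tendsto hν hφ_meas hφ hlam hG'.1 hG'.2.2
  have e1 := limit_energyVec_unique hν hφ_meas hφ hlam hint hF hF' hξ hξ'
  have e2 := limit_energyVec_unique hν hφ_meas hφ hlam hint hG hG' hη hη'
  subst e1 e2
  simp only [FunctionForm.closure]
  rw [dif_pos h]
  refine Tendsto.limUnder_eq ?_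
  simp only [form_eq_inner hν hφ_meas hφ hlam (hF'.1 _) (hG'.1 _)]
  exact hξ'.inner hη' (𝕜 := ℝ)

theorem tendsto_form_closure {F G : ℕ → Path d → ℝ} {u v : Lp ℝ 2 (weighted φ ν)}
    (hF : (wienerForm lam φ ν).Approximates F u) (hG : (wienerForm lam φ ν).Approximates G v) :
    Tendsto (fun n => (wienerForm lam φ ν).form (F n) (G n)) atTop
      (𝓝 (((wienerForm lam φ ν).closure (weighted φ ν)).form u v)) := by
  obtain ⟨ξ, hξ⟩ := IsFormCauchy.exists_tendsto hν hφ_meas hφ hlam hF.1 hF.2.2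
  obtain ⟨η, hη⟩ := IsFormCauchy.exists_tendsto hν hφ_meas hφ hlam hG.1 hG.2.2
  rw [closure_form_eq hν hφ_meas hφ hlam hint hF hG hξ hη]
  simp only [form_eq_inner hν hφ_meas hφ hlam (hF.1 _) (hG.1 _)]
  exact hξ.inner hη (𝕜 := ℝ)

/-- At almost every point u or v vanishes, and with it ξ_n or η_n. Each coordinate inner product is
the integral of a function that is zero a.e. -/
theorem isLocal_closure : ((wienerForm lam φ ν).closure (weighted φ ν)).IsLocal := by
  rintro u ⟨F, hF⟩ v ⟨G, hG⟩ hdisj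
  obtain ⟨ξ, hξ⟩ := IsFormCauchy.exists_tendsto hν hφ_meas hφ hlam hF.1 hF.2.2
  obtain ⟨η, hη⟩ := IsFormCauchy.exists_tendsto hν hφ_meas hφ hlam hG.1 hG.2.2
  rw [closure_form_eq hν hφ_meas hφ hlam hint hF hG hξ hη, lp.inner_eq_tsum]
  refine (tsum_congr fun n => ?_).trans tsum_zero
  rw [L2.inner_def]
  refine integral_eq_zero_of_ae ?_
  filter_upwards [ae_mem_l2Support u, ae_mem_l2Support v,
    ae_eq_zero_of_tendsto_energyVec hν hφ_meas hφ hlam hint hF.1 (Lp.aestronglyMeasurable u)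
      hF.2.1 hξ n,
    ae_eq_zero_of_tendsto_energyVec hν hφ_meas hφ hlam hint hG.1 (Lp.aestronglyMeasurable v)
      hG.2.1 hη n] with γ hu hv hξ0 hη0
  rw [Pi.zero_apply]
  by_cases h1 : u γ = 0
  · rw [hξ0 h1, inner_zero_left]
  · have h2 : v γ = 0 := by
      by_contra h2
      exact Set.disjoint_left.1 hdisj (hu h1) (hv h2)
    rw [hη0 h2, inner_zero_right]

end Embedding

end WienerForm

theorem mainTheorem7 (d : ℕ) [NeZero d] (ν : Measure (WienerForm.Path d))
    (hν : WienerForm.IsWienerMeasure ν) (lam : ℕ → ℝ) (hlam_pos : ∀ n, 0 < lam n)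
    (hlam_mono : Monotone lam) (φ : WienerForm.Path d → ℝ) (hφ_meas : Measurable φ)
    (hφ_bound : ∃ C : ℝ, ∀ᵐ γ ∂ν, 0 < φ γ ∧ φ γ ≤ C)
    (hφ : ∀ F ∈ WienerForm.cylinderFunctions d, Integrable (fun γ => F γ / φ γ) ν) :
    -- under the summability condition on the sequence, the form is defined on all of `Z`
    (∀ c : ℕ → ℕ, c 0 = 0 → (∀ q, c q ≤ 1) → WienerForm.DyadicSummable d lam c →
      (WienerForm.wienerForm lam φ ν).dom = WienerForm.cylinderFunctions d) ∧
    -- the form is closable, and its closure is well defined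
    (WienerForm.wienerForm lam φ ν).IsClosable (WienerForm.weighted φ ν) ∧
    (∀ (u v : Lp ℝ 2 (WienerForm.weighted φ ν)) (F G : ℕ → WienerForm.Path d → ℝ),
      (WienerForm.wienerForm lam φ ν).Approximates F u →
      (WienerForm.wienerForm lam φ ν).Approximates G v →
      Tendsto (fun n => (WienerForm.wienerForm lam φ ν).form (F n) (G n)) atTop
        (𝓝 (((WienerForm.wienerForm lam φ ν).closure (WienerForm.weighted φ ν)).form u v))) ∧
    -- the closure is local
    ((WienerForm.wienerForm lam φ ν).closure (WienerForm.weighted φ ν)).IsLocal := by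
  have hint : Integrable (fun γ => 1 / φ γ) ν := hφ _ (WienerForm.const_mem 1)
  refine ⟨fun c _ _ hc => ?_, ?_, fun u v F G hF hG => ?_, ?_⟩
  · ext F
    exact ⟨fun hF => hF.1, fun hF => ⟨hF, WienerForm.finiteEnergy_of_dyadicSummable hν hφ_meas
      hφ_bound hlam_pos hlam_mono hc hF⟩⟩
  · exact WienerForm.isClosable_wienerForm hν hφ_meas hφ_bound hlam_pos hint
  · exact WienerForm.tendsto_form_closure hν hφ_meas hφ_bound hlam_pos hint hF hG
  · exact WienerForm.isLocal_closure hν hφ_meas hφ_bound hlam_pos hint
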